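/- Let $E=(E^0,E^1,r,s)$ be a finite directed graph in which every vertex receives at least one edge and emits at least one edge. Let $E^\infty$ be the compact space of right-infinite paths $c=c_0c_1c_2\cdots$ (edges with $s(c_i)=r(c_{i+1})$), put $r(c)=r(c_0)$, let $\sigma(c_0c_1c_2\cdots)=c_1c_2\cdots$ be the shift on $E^\infty$, let $E^{(-\infty,\infty)}$ be the compact space of two-sided infinite paths, $E^{[-k,\infty)}$ the space of paths $c_{-k}c_{-k+1}\cdots$, and $\pi_k:E^{(-\infty,\infty)}\to E^{[-k,\infty)}$ the projections. Put $A=C(E^\infty)$, $\alpha(f)=f\circ\sigma$, and $$L(f)(c)=\frac1{|s^{-1}(r(c))|}\sum_{s(e)=r(c)}f(ec).$$ Let $M_L$ be Exel's correspondence over $A$: the completion of $A$ with right action $x\cdot f=x\alpha(f)$, inner product $\langle x,y\rangle=L(x^*y)$, and left action by multiplication. Let $\{w(e):e\in E^1\}$ be non-zero complex numbers with $\sum_{s(e)=v}|w(e)|^2=|s^{-1}(v)|$ for every $v\in E^0$, and let $m=\sum_{e\in E^1}w(e)\chi_{Z(e)}\in C(E^\infty)$, where $Z(e)=\{c:c_0=e\}$.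 For $c\in E^\infty$ there is a probability measure $\mu^c$ on $E^{(-\infty,\infty)}$, carried by $\pi_0^{-1}(c)$, such that for all $k\ge 0$ and $x\in C(E^{[-k,\infty)})$ $$\int x\circ\pi_k\,d\mu^c=\sum_{d}x(d)|w_k(d)|^2,\qquad |w_k(d)|^2=\prod_{j=-k}^{-1}|w(d_j)|^2\,|s^{-1}(s(d_j))|^{-1},$$ where $d$ runs over the elements of $E^{[-k,\infty)}$ with $d_0d_1\cdots=c$. Let $X_\infty(E)$ be the Hilbert $A$-module obtained by completing $C(E^{(-\infty,\infty)})$ with $(x\cdot f)(d)=x(d)f(\pi_0(d))$ and $\langle x,y\rangle(c)=\int\overline{x}\,y\,d\mu^c$. Let $h$ be the backward shift on $E^{(-\infty,\infty)}$, $h(c)_i=c_{i+1}$, and $(Dx)(c)=m(\pi_0(c))\,x(h(c))$ for $x\in C(E^{(-\infty,\infty)})$. Then: 1. $m$ is a filter in $M_L$, that is, $\langle m,m\rangle=1$. 2. $D$ extends to a bounded linear isomorphism $D$ (with bounded inverse) of $X_\infty(E)$ onto itself, and $(X_\infty(E),D,1)$ is a scaling function for $m$. That is, under the identification of $X_\infty(E)$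 with $X_\infty(E)\otimes_AM_L$ by $y\mapsto y\otimes 1$, the map $D$ becomes a Hilbert-module isomorphism $D':x\mapsto (Dx)\otimes 1$ of $X_\infty(E)$ onto the internal tensor product $X_\infty(E)\otimes_A M_L$; moreover $\langle 1,1\rangle=1$ and $D'1=1\otimes m$. 3. Let $(M_\infty,\iota^k)$ be the direct limit of the Hilbert modules $M_L^{\otimes k}$ (internal tensor powers over $A$, with $M_L^{\otimes 0}=A$) under the inner-product preserving maps $T_k:M_L^{\otimes k}\to M_L^{\otimes(k+1)}$, $T_k n=m\otimes n$. There is a Hilbert-module isomorphism $Q$ of $M_\infty$ onto $X_\infty(E)$ such that the submodules $V_k=Q(\iota^k(M_L^{\otimes k}))$, $k\ge 0$, form a projective multi-resolution analysis for $X_\infty(E)$: (i) $V_0$ is a complemented $A$-submodule of $X_\infty(E)$; (ii) $V_k=D^{-k}(V_0)$ for $k\ge0$; (iii) $V_k$ is a complemented submodule of $V_{k+1}$ for $k\ge0$; (iv) $\bigcup_{k\ge0}V_k$ is dense in $X_\infty(E)$. (A closed submodule $V$ of $W$ is complemented if every element of $W$ is the sum of an element of $V$ and an element of $W$ orthogonal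 to $V$.) -/

import Mathlib

open scoped ComplexOrder TensorProduct
open UniformSpace

universe u

noncomputable section

lemma ContinuousMap.isClosed_nonneg_complex (K : Type u) [TopologicalSpace K] :
    IsClosed {f : C(K, ℂ) | 0 ≤ f} := by
  have : {f : C(K, ℂ) | 0 ≤ f} = ⋂ c : K, {f : C(K, ℂ) | 0 ≤ f c} := by
    ext f; simp [ContinuousMap.le_def]
  rw [this]
  refine isClosed_iInter fun c => ?_
  exact isClosed_le continuous_const (continuous_eval_const c)

/-- A right Hilbert module over the commutative C⋆-algebra `C(K, ℂ)`. As the coefficient algebra is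
commutative, the right action `x · f` is written `f • x`. The inner product is `ℂ`-linear and
`C(K, ℂ)`-linear in the second variable. -/
structure HilbMod (K : Type u) [TopologicalSpace K] [CompactSpace K] where
  carrier : Type u
  [normedAddCommGroup : NormedAddCommGroup carrier]
  [normedSpace : NormedSpace ℂ carrier]
  [module : Module C(K, ℂ) carrier]
  [isScalarTower : IsScalarTower ℂ C(K, ℂ) carrier]
  [cstarModule : CStarModule C(K, ℂ) carrier]
  [completeSpace : CompleteSpace carrier]

/-- A `C(K, ℂ)`-module with a positive semidefinite `C(K, ℂ)`-valued inner product. -/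
structure PreHilbMod (K : Type u) [TopologicalSpace K] [CompactSpace K] where
  carrier : Type u
  [addCommGroup : AddCommGroup carrier]
  [moduleC : Module ℂ carrier]
  [module : Module C(K, ℂ) carrier]
  [isScalarTower : IsScalarTower ℂ C(K, ℂ) carrier]
  form : carrier → carrier → C(K, ℂ)
  form_add : ∀ x y z, form x (y + z) = form x y + form x z
  form_smul : ∀ (f : C(K, ℂ)) x y, form x (f • y) = f * form x y
  star_form : ∀ x y, star (form x y) = form y x
  form_self_nonneg : ∀ x, 0 ≤ form x x

section Modules

variable {K : Type u} [TopologicalSpace K] [CompactSpace K]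

instance : CoeSort (HilbMod K) (Type u) := ⟨HilbMod.carrier⟩

attribute [instance] HilbMod.normedAddCommGroup HilbMod.normedSpace HilbMod.module
  HilbMod.isScalarTower HilbMod.cstarModule HilbMod.completeSpace

attribute [instance] PreHilbMod.addCommGroup PreHilbMod.moduleC PreHilbMod.module
  PreHilbMod.isScalarTower

namespace PreHilbMod

variable (P : PreHilbMod K)

lemma form_smulC (z : ℂ) (x y : P.carrier) : P.form x (z • y) = z • P.form x y := by
  have h : z • y = (z • (1 : C(K, ℂ))) • y := by rw [smul_assoc, one_smul]
  rw [h, P.form_smul, smul_mul_assoc, one_mul]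

lemma add_form (x y z : P.carrier) : P.form (x + y) z = P.form x z + P.form y z := by
  rw [← P.star_form z (x + y), P.form_add, star_add, P.star_form, P.star_form]

lemma smul_form (f : C(K, ℂ)) (x y : P.carrier) : P.form (f • x) y = star f * P.form x y := by
  rw [← P.star_form y (f • x), P.form_smul, star_mul, P.star_form, mul_comm]

lemma smulC_form (z : ℂ) (x y : P.carrier) : P.form (z • x) y = star z • P.form x y := by
  rw [← P.star_form y (z • x), P.form_smulC, star_smul, P.star_form]

/-- Evaluation of the inner product at a point, as a scalar semi-inner product. -/
@[reducible] def coreAt (c : K) : PreInnerProductSpace.Core ℂ P.carrier where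
  inner x y := P.form x y c
  conj_inner_symm x y := by
    have := congrArg (fun f : C(K, ℂ) => f c) (P.star_form y x)
    simpa using this
  re_inner_nonneg x := by
    have := P.form_self_nonneg x c
    exact (Complex.le_def.1 this).1
  add_left x y z := by simp [P.add_form]
  smul_left x y r := by simp [P.smulC_form]

lemma norm_form_apply_sq_le (x y : P.carrier) (c : K) :
    ‖P.form x y c‖ ^ 2 ≤ ‖P.form x x‖ * ‖P.form y y‖ := by
  let := P.coreAt c
  have h := InnerProductSpace.Core.inner_mul_inner_self_le (𝕜 := ℂ) (F := P.carrier) x y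
  have h1 : ‖P.form y x c‖ = ‖P.form x y c‖ := by
    rw [← P.star_form x y]; simp
  change ‖P.form x y c‖ * ‖P.form y x c‖ ≤ (P.form x x c).re * (P.form y y c).re at h
  rw [h1, ← sq] at h
  refine h.trans ?_
  have hx : (P.form x x c).re ≤ ‖P.form x x‖ :=
    (Complex.re_le_norm _).trans ((P.form x x).norm_coe_le_norm c)
  have hy : (P.form y y c).re ≤ ‖P.form y y‖ :=
    (Complex.re_le_norm _).trans ((P.form y y).norm_coe_le_norm c)
  exact mul_le_mul hx hy ((Complex.le_def.1 (P.form_self_nonneg y c)).1) (norm_nonneg _)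

/-- The seminorm `‖x‖ = ‖⟨x, x⟩‖ ^ (1/2)`. -/
instance : Norm P.carrier := ⟨fun x => √‖P.form x x‖⟩

lemma norm_def (x : P.carrier) : ‖x‖ = √‖P.form x x‖ := rfl

lemma norm_sq (x : P.carrier) : ‖x‖ ^ 2 = ‖P.form x x‖ := Real.sq_sqrt (norm_nonneg _)

lemma norm_form_le (x y : P.carrier) : ‖P.form x y‖ ≤ ‖x‖ * ‖y‖ := by
  refine (ContinuousMap.norm_le _ (mul_nonneg (Real.sqrt_nonneg _) (Real.sqrt_nonneg _))).2
    fun c => ?_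
  rw [← Real.sqrt_mul (norm_nonneg (P.form x x))]
  exact Real.le_sqrt_of_sq_le (P.norm_form_apply_sq_le x y c)

lemma seminormCore : SeminormedSpace.Core ℂ P.carrier where
  norm_nonneg _ := Real.sqrt_nonneg _
  norm_smul z x := by
    rw [P.norm_def, P.norm_def, P.form_smulC, P.smulC_form, smul_smul, norm_smul]
    rw [Real.sqrt_mul (norm_nonneg _)]
    congr 1
    rw [norm_mul, norm_star, Real.sqrt_mul_self (norm_nonneg _)]
  norm_triangle x y := by
    have h0 : 0 ≤ ‖x‖ := Real.sqrt_nonneg _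
    have h1 : 0 ≤ ‖y‖ := Real.sqrt_nonneg _
    refine le_of_sq_le_sq ?_ (add_nonneg h0 h1)
    rw [P.norm_sq, P.add_form, P.form_add, P.form_add]
    have hxy := P.norm_form_le x y
    have hyx := P.norm_form_le y x
    have hx := P.norm_sq x
    have hy := P.norm_sq y
    have := norm_add₃_le (a := P.form x x + P.form x y) (b := P.form y x) (c := P.form y y)
    have h3 := norm_add_le (P.form x x) (P.form x y)
    rw [← add_assoc]
    nlinarith

instance : SeminormedAddCommGroup P.carrier := SeminormedAddCommGroup.ofCore P.seminormCore

instance : NormedSpace ℂ P.carrier where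
  norm_smul_le z x := (P.seminormCore.norm_smul z x).le

instance : IsBoundedSMul C(K, ℂ) P.carrier := by
  refine IsBoundedSMul.of_norm_smul_le fun f x => ?_
  rw [P.norm_def, P.norm_def, P.form_smul, P.smul_form, ← mul_assoc]
  refine (Real.sqrt_le_sqrt ((norm_mul_le _ _).trans
    (mul_le_mul_of_nonneg_right (norm_mul_le _ _) (norm_nonneg _)))).trans ?_
  rw [norm_star, Real.sqrt_mul (by positivity), Real.sqrt_mul_self (norm_nonneg _)]

/-- The inner product as a continuous sesquilinear map. -/
def formL : P.carrier →L⋆[ℂ] P.carrier →L[ℂ] C(K, ℂ) :=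
  LinearMap.mkContinuous₂
    (LinearMap.mk₂'ₛₗ (starRingEnd ℂ) (RingHom.id ℂ) P.form (fun x y z => P.add_form x y z)
      (fun z x y => P.smulC_form z x y) (fun x y z => P.form_add x y z)
      (fun z x y => P.form_smulC z x y)) 1 (fun x y => by
        rw [one_mul]; exact P.norm_form_le x y)

lemma continuous_form : Continuous (Function.uncurry P.form) :=
  (show Continuous (Function.uncurry fun x y => P.formL x y) from
    (P.formL.continuous.comp continuous_fst).clm_apply continuous_snd)

instance : Inner C(K, ℂ) P.carrier := ⟨P.form⟩

lemma completion_inner_coe (x y : P.carrier) :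
    inner C(K, ℂ) (x : Completion P.carrier) (y : Completion P.carrier) = P.form x y :=
  (Completion.isDenseInducing_coe.prodMap Completion.isDenseInducing_coe).extend_eq
    P.continuous_form (x, y)

lemma completion_continuous_inner :
    Continuous (Function.uncurry (inner C(K, ℂ) (E := Completion P.carrier))) := by
  let inner' : P.carrier →+ P.carrier →+ C(K, ℂ) :=
    { toFun := fun x => (P.formL x).toLinearMap.toAddMonoidHom
      map_zero' := by ext; simp
      map_add' := fun x y => by ext; simp }
  have : Continuous fun p : P.carrier × P.carrier => inner' p.1 p.2 := P.continuous_form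
  rw [Completion.toInner, inner, Function.uncurry_curry _]
  exact (Completion.isDenseInducing_toCompl P.carrier).extend_Z_bilin
    (Completion.isDenseInducing_toCompl P.carrier) this

lemma completion_continuous_inner' {α : Type*} [TopologicalSpace α]
    {f g : α → Completion P.carrier} (hf : Continuous f) (hg : Continuous g) :
    Continuous fun x => inner C(K, ℂ) (f x) (g x) :=
  P.completion_continuous_inner.comp (hf.prodMk hg :)

lemma completion_norm_eq (x : Completion P.carrier) : ‖x‖ = √‖inner C(K, ℂ) x x‖ :=
  Completion.induction_on x
    (isClosed_eq continuous_norm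
      ((P.completion_continuous_inner' continuous_id continuous_id).norm.sqrt))
    fun a => by rw [Completion.norm_coe, P.completion_inner_coe, P.norm_def]

instance : CStarModule C(K, ℂ) (Completion P.carrier) where
  inner_add_right {x y z} := by
    refine Completion.induction_on₃ x y z (isClosed_eq ?_ ?_) fun a b c => ?_
    · exact P.completion_continuous_inner' (by fun_prop) (by fun_prop)
    · exact (P.completion_continuous_inner' (by fun_prop) (by fun_prop)).add
        (P.completion_continuous_inner' (by fun_prop) (by fun_prop))
    · simp only [← Completion.coe_add, P.completion_inner_coe, P.form_add]
  inner_self_nonneg {x} := by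
    refine Completion.induction_on x ((ContinuousMap.isClosed_nonneg_complex K).preimage
      (P.completion_continuous_inner' continuous_id continuous_id)) fun a => ?_
    simpa only [id, P.completion_inner_coe] using P.form_self_nonneg a
  inner_self {x} := by
    rw [← norm_eq_zero (a := x), P.completion_norm_eq, Real.sqrt_eq_zero (norm_nonneg _),
      norm_eq_zero]
  inner_op_smul_right {f x y} := by
    refine Completion.induction_on₂ x y (isClosed_eq ?_ ?_) fun a b => ?_
    · exact P.completion_continuous_inner' continuous_fst (continuous_snd.const_smul f)
    · exact continuous_const.mul (P.completion_continuous_inner' continuous_fst continuous_snd)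
    · simp only [← Completion.coe_smul, P.completion_inner_coe, P.form_smul]
  inner_smul_right_complex {z x y} := by
    refine Completion.induction_on₂ x y (isClosed_eq ?_ ?_) fun a b => ?_
    · exact P.completion_continuous_inner' continuous_fst (continuous_snd.const_smul z)
    · exact (P.completion_continuous_inner' continuous_fst continuous_snd).const_smul z
    · simp only [← Completion.coe_smul, P.completion_inner_coe, P.form_smulC]
  star_inner x y := by
    refine Completion.induction_on₂ x y (isClosed_eq ?_ ?_) fun a b => ?_
    · exact (P.completion_continuous_inner' continuous_fst continuous_snd).star
    · exact P.completion_continuous_inner' continuous_snd continuous_fst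
    · simp only [P.completion_inner_coe, P.star_form]
  norm_eq_sqrt_norm_inner_self x := P.completion_norm_eq x

/-- The Hilbert module obtained by dividing out the vectors of length zero and completing. -/
def completion : HilbMod K where
  carrier := Completion P.carrier

/-- The canonical map of a semi-inner-product module into its completion. -/
def toCompletion : P.carrier →ₗ[C(K, ℂ)] P.completion where
  toFun x := (x : Completion P.carrier)
  map_add' x y := Completion.coe_add x y
  map_smul' f x := Completion.coe_smul f x

end PreHilbMod


/-- A correspondence over `C(K, ℂ)`: a Hilbert module together with a left action by adjointable
operators, given by a unital `*`-homomorphism (so that it is essential as a left module). -/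
structure Corr (K : Type u) [TopologicalSpace K] [CompactSpace K] extends HilbMod K where
  left : C(K, ℂ) →ₐ[ℂ] Module.End C(K, ℂ) carrier
  inner_left : ∀ (f : C(K, ℂ)) (x y : carrier),
    inner C(K, ℂ) (left f x) y = inner C(K, ℂ) x (left (star f) y)

/-- A semi-inner-product module with a left action, to be completed to a correspondence. -/
structure PreCorr (K : Type u) [TopologicalSpace K] [CompactSpace K] extends PreHilbMod K where
  left : C(K, ℂ) →ₐ[ℂ] Module.End C(K, ℂ) carrier
  form_left : ∀ (f : C(K, ℂ)) (x y : carrier), form (left f x) y = form x (left (star f) y)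

lemma exists_complement_square (f : C(K, ℂ)) :
    ∃ g : C(K, ℂ), star g * g = ((‖f‖ ^ 2 : ℝ) : ℂ) • (1 : C(K, ℂ)) - star f * f := by
  refine ⟨⟨fun c => ((√(‖f‖ ^ 2 - ‖f c‖ ^ 2) : ℝ) : ℂ), by fun_prop⟩, ?_⟩
  ext c
  have h : 0 ≤ ‖f‖ ^ 2 - ‖f c‖ ^ 2 := by
    have := f.norm_coe_le_norm c
    have := norm_nonneg (f c)
    nlinarith
  simp only [ContinuousMap.coe_mul, ContinuousMap.coe_star, Pi.mul_apply, Pi.star_apply,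
    ContinuousMap.coe_mk, ContinuousMap.coe_sub, ContinuousMap.coe_smul, Pi.sub_apply,
    Pi.smul_apply, ContinuousMap.coe_one, Pi.one_apply, RCLike.star_def, Complex.conj_ofReal,
    Complex.conj_mul', smul_eq_mul, mul_one]
  rw [← Complex.ofReal_mul, Real.mul_self_sqrt h]
  push_cast
  ring

namespace PreCorr

variable (P : PreCorr K)

lemma norm_left_le (f : C(K, ℂ)) (x : P.carrier) : ‖P.left f x‖ ≤ ‖f‖ * ‖x‖ := by
  obtain ⟨g, hg⟩ := exists_complement_square f
  have h1 : P.form (P.left g x) (P.left g x) =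
      ((‖f‖ ^ 2 : ℝ) : ℂ) • P.form x x - P.form (P.left f x) (P.left f x) := by
    rw [P.form_left, P.form_left, ← Module.End.mul_apply, ← Module.End.mul_apply, ← map_mul,
      ← map_mul, hg, map_sub, map_smul, map_one, LinearMap.sub_apply, LinearMap.smul_apply,
      Module.End.one_apply, sub_eq_add_neg, P.form_add, P.form_smulC, ← neg_one_smul ℂ,
      P.form_smulC, neg_one_smul, ← sub_eq_add_neg]
  have h2 := P.form_self_nonneg (P.left g x)
  rw [h1, sub_nonneg] at h2
  have h3 : ‖P.form (P.left f x) (P.left f x)‖ ≤ ‖((‖f‖ ^ 2 : ℝ) : ℂ) • P.form x x‖ :=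
    CStarAlgebra.norm_le_norm_of_nonneg_of_le (P.form_self_nonneg _) h2
  rw [norm_smul, Complex.norm_real, Real.norm_of_nonneg (by positivity), ← P.norm_sq,
    ← P.norm_sq, ← mul_pow] at h3
  exact le_of_sq_le_sq h3 (by positivity)

lemma uniformContinuous_left (f : C(K, ℂ)) : UniformContinuous (P.left f) :=
  ((P.left f).toAddMonoidHom.mkNormedAddGroupHom ‖f‖ (P.norm_left_le f)).uniformContinuous

/-- The extension of the left action to the completion. -/
def leftCompletion (f : C(K, ℂ)) : Module.End C(K, ℂ) (Completion P.carrier) where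
  toFun := Completion.map (P.left f)
  map_add' x y := by
    have hc : Continuous (Completion.map (P.left f)) := Completion.continuous_map
    refine Completion.induction_on₂ x y (isClosed_eq ?_ ?_) fun a b => ?_
    · exact hc.comp continuous_add
    · exact (hc.comp continuous_fst).add (hc.comp continuous_snd)
    · rw [← Completion.coe_add, Completion.map_coe (P.uniformContinuous_left f),
        Completion.map_coe (P.uniformContinuous_left f),
        Completion.map_coe (P.uniformContinuous_left f), ← Completion.coe_add, map_add]
  map_smul' g x := by
    have hc : Continuous (Completion.map (P.left f)) := Completion.continuous_map
    refine Completion.induction_on x (isClosed_eq ?_ ?_) fun a => ?_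
    · exact hc.comp (continuous_const_smul g)
    · exact (continuous_const_smul g).comp hc
    · rw [← Completion.coe_smul, Completion.map_coe (P.uniformContinuous_left f),
        Completion.map_coe (P.uniformContinuous_left f), ← Completion.coe_smul, map_smul, RingHom.id_apply]

lemma leftCompletion_coe (f : C(K, ℂ)) (x : P.carrier) :
    P.leftCompletion f (x : Completion P.carrier) = (P.left f x : P.carrier) :=
  Completion.map_coe (P.uniformContinuous_left f) x

lemma continuous_leftCompletion (f : C(K, ℂ)) : Continuous (P.leftCompletion f) :=
  Completion.continuous_map

lemma end_ext {S T : Module.End C(K, ℂ) (Completion P.carrier)} (hS : Continuous S)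
    (hT : Continuous T) (h : ∀ x : P.carrier, S (x : Completion P.carrier) = T x) :
    S = T := by
  ext x
  exact Completion.induction_on x (isClosed_eq hS hT) h

/-- The extension of the left action to the completion, as a homomorphism. -/
def leftCompletionHom : C(K, ℂ) →ₐ[ℂ] Module.End C(K, ℂ) (Completion P.carrier) :=
  AlgHom.ofLinearMap
    { toFun := P.leftCompletion
      map_add' := fun f g => P.end_ext (P.continuous_leftCompletion _)
        ((P.continuous_leftCompletion f).add (P.continuous_leftCompletion g)) fun x => by
          rw [LinearMap.add_apply]
          simp only [P.leftCompletion_coe, map_add, LinearMap.add_apply, Completion.coe_add]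
      map_smul' := fun z f => P.end_ext (P.continuous_leftCompletion _)
        ((P.continuous_leftCompletion f).const_smul z) fun x => by
          rw [RingHom.id_apply, LinearMap.smul_apply]
          simp only [P.leftCompletion_coe, map_smul, LinearMap.smul_apply, Completion.coe_smul] }
    (P.end_ext (P.continuous_leftCompletion _) continuous_id fun x => by
      simp [P.leftCompletion_coe])
    (fun f g => P.end_ext (P.continuous_leftCompletion _)
      ((P.continuous_leftCompletion f).comp (P.continuous_leftCompletion g)) fun x => by
        simp [P.leftCompletion_coe])

lemma inner_leftCompletion (f : C(K, ℂ)) (x y : Completion P.carrier) :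
    inner C(K, ℂ) (P.leftCompletion f x) y = inner C(K, ℂ) x (P.leftCompletion (star f) y) := by
  refine Completion.induction_on₂ x y (isClosed_eq ?_ ?_) fun a b => ?_
  · exact P.completion_continuous_inner' ((P.continuous_leftCompletion f).comp continuous_fst)
      continuous_snd
  · exact P.completion_continuous_inner' continuous_fst
      ((P.continuous_leftCompletion (star f)).comp continuous_snd)
  · rw [P.leftCompletion_coe, P.leftCompletion_coe, P.completion_inner_coe,
      P.completion_inner_coe, P.form_left]

/-- The correspondence obtained by dividing out the vectors of length zero and completing. -/
def completion : Corr K where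
  toHilbMod := P.toPreHilbMod.completion
  left := P.leftCompletionHom
  inner_left f x y := P.inner_leftCompletion f x y

end PreCorr

lemma exists_sqrt_negPart {B : Type u} [CStarAlgebra B] (G : B) (hG : IsSelfAdjoint G) :
    ∃ N R : B, star N = N ∧ star R = R ∧ R * R = N ∧ N * G * N = -(N * N * N) ∧
      (N = 0 → ∃ S : B, star S * S = G) := by
  let := CStarAlgebra.spectralOrder B
  have := CStarAlgebra.spectralOrderedRing B
  have hN0 : 0 ≤ G⁻ := CFC.negPart_nonneg G
  refine ⟨G⁻, CFC.sqrt G⁻, (IsSelfAdjoint.of_nonneg hN0).star_eq,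
    (IsSelfAdjoint.of_nonneg (CFC.sqrt_nonneg _)).star_eq, CFC.sqrt_mul_sqrt_self _ hN0, ?_, ?_⟩
  · have h : G⁻ * G * G⁻ = G⁻ * (G⁺ - G⁻) * G⁻ := by rw [CFC.posPart_sub_negPart G]
    rw [h, mul_sub, CFC.negPart_mul_posPart, zero_sub, neg_mul]
  · intro h
    have h0 : 0 ≤ G := (CFC.negPart_eq_zero_iff G).1 h
    refine ⟨CFC.sqrt G, ?_⟩
    rw [(IsSelfAdjoint.of_nonneg (CFC.sqrt_nonneg G)).star_eq]
    exact CFC.sqrt_mul_sqrt_self G h0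

/-- The Gram matrix of finitely many vectors in a Hilbert module is of the form `H* H`. -/
lemma exists_gram_factor {ι : Type u} [Fintype ι] (X : HilbMod K) (x : ι → X) :
    ∃ H : ι → ι → C(K, ℂ), ∀ i j,
      inner C(K, ℂ) (x i) (x j) = ∑ p, star (H p i) * H p j := by
  classical
  set G : CStarMatrix ι ι C(K, ℂ) :=
    CStarMatrix.ofMatrix (Matrix.of fun i j => inner C(K, ℂ) (x i) (x j)) with hG
  have hGa : ∀ i j, G i j = inner C(K, ℂ) (x i) (x j) := fun i j => rfl
  have hsa : IsSelfAdjoint G := by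
    ext i j : 1
    rw [CStarMatrix.star_apply, hGa, hGa, CStarModule.star_inner]
  have hmul : ∀ (S T : CStarMatrix ι ι C(K, ℂ)) i j, (S * T) i j = ∑ k, S i k * T k j :=
    fun S T i j => CStarMatrix.mul_apply
  have hstar : ∀ (S : CStarMatrix ι ι C(K, ℂ)) i j, star S i j = star (S j i) :=
    fun S i j => CStarMatrix.star_apply
  obtain ⟨N, R, hNs, hRs, hRR, hNG, hfac⟩ := exists_sqrt_negPart G hsa
  have h3 : N * N * N = star (R * N) * (R * N) := by
    rw [star_mul, hNs, hRs, mul_assoc N R, ← mul_assoc R R N, hRR, mul_assoc]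
  have hdiag : ∀ i, 0 ≤ (N * G * N) i i := by
    intro i
    have : (N * G * N) i i = inner C(K, ℂ) (∑ j, N j i • x j) (∑ j, N j i • x j) := by
      simp only [hmul, CStarModule.inner_sum_left, CStarModule.inner_sum_right,
        CStarModule.inner_op_smul_left, CStarModule.inner_op_smul_right, Finset.sum_mul,
        Finset.mul_sum]
      refine Finset.sum_congr rfl fun k _ => Finset.sum_congr rfl fun j _ => ?_
      have : N i j = star (N j i) := by
        rw [← hstar, hNs]
      rw [hGa, this]
      ring
    rw [this]
    exact CStarModule.inner_self_nonneg
  have hzero : R * N = 0 := by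
    ext p i : 1
    have h1 := hdiag i
    have h2 : (star (R * N) * (R * N)) i i = ∑ q, star ((R * N) q i) * (R * N) q i := by
      rw [hmul]
      exact Finset.sum_congr rfl fun q _ => by rw [hstar]
    rw [hNG, h3, CStarMatrix.neg_apply, h2, neg_nonneg] at h1
    have h5 : ∑ q, star ((R * N) q i) * (R * N) q i = 0 :=
      le_antisymm h1 (Finset.sum_nonneg fun q _ => star_mul_self_nonneg _)
    have h6 := (Finset.sum_eq_zero_iff_of_nonneg fun q _ => star_mul_self_nonneg _).1 h5 p
      (Finset.mem_univ _)
    rw [CStarMatrix.zero_apply]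
    exact (CStarRing.star_mul_self_eq_zero_iff _).1 h6
  have hN : N = 0 := by
    have : star N * N = 0 := by rw [hNs, ← hRR, mul_assoc, hRR, hzero, mul_zero]
    exact (CStarRing.star_mul_self_eq_zero_iff _).1 this
  obtain ⟨S, hS⟩ := hfac hN
  refine ⟨fun i j => S i j, fun i j => ?_⟩
  rw [← hGa, ← hS, hmul]
  exact Finset.sum_congr rfl fun q _ => by rw [hstar]

namespace HilbMod

variable (X : HilbMod K) (M : Corr K)

/-- The sesquilinear form `⟨x ⊗ m, y ⊗ n⟩ = ⟨m, ⟨x, y⟩ · n⟩` on the algebraic tensor product; the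
element `x ⊗ m` is represented by `m ⊗ₜ x`. -/
def tensorForm : M.carrier ⊗[ℂ] X.carrier →ₗ⋆[ℂ] M.carrier ⊗[ℂ] X.carrier →ₗ[ℂ] C(K, ℂ) :=
  TensorProduct.lift <| LinearMap.mk₂'ₛₗ (starRingEnd ℂ) (starRingEnd ℂ)
    (fun m x => TensorProduct.lift <| LinearMap.mk₂ ℂ
      (fun n y => inner C(K, ℂ) m (M.left (inner C(K, ℂ) x y) n))
      (fun n n' y => by simp)
      (fun z n y => by
        rw [LinearMap.map_smul_of_tower, CStarModule.inner_smul_right_complex])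
      (fun n y y' => by simp)
      (fun z n y => by simp))
    (fun m m' x => by ext n y; simp)
    (fun z m x => by ext n y; simp)
    (fun m x x' => by ext n y; simp)
    (fun z m x => by ext n y; simp)

@[simp] lemma tensorForm_tmul (m n : M.carrier) (x y : X) :
    X.tensorForm M (m ⊗ₜ x) (n ⊗ₜ y) = inner C(K, ℂ) m (M.left (inner C(K, ℂ) x y) n) := rfl

lemma star_tensorForm (s t : M.carrier ⊗[ℂ] X.carrier) :
    star (X.tensorForm M s t) = X.tensorForm M t s := by
  induction s with
  | zero => simp
  | add s s' hs hs' => simp [hs, hs']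
  | tmul m x =>
    induction t with
    | zero => simp
    | add t t' ht ht' => simp [ht, ht']
    | tmul n y =>
      rw [tensorForm_tmul, tensorForm_tmul, CStarModule.star_inner, M.inner_left,
        CStarModule.star_inner]

lemma tensorForm_self_nonneg (t : M.carrier ⊗[ℂ] X.carrier) : 0 ≤ X.tensorForm M t t := by
  obtain ⟨S, rfl⟩ := TensorProduct.exists_finset t
  obtain ⟨H, hH⟩ := exists_gram_factor X (fun i : S => i.1.2)
  have h : X.tensorForm M (∑ i ∈ S, i.1 ⊗ₜ[ℂ] i.2) (∑ i ∈ S, i.1 ⊗ₜ[ℂ] i.2) =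
      ∑ p : S, inner C(K, ℂ) (∑ i : S, M.left (H p i) i.1.1) (∑ i : S, M.left (H p i) i.1.1) := by
    rw [← Finset.sum_coe_sort S]
    simp only [map_sum, LinearMap.sum_apply, tensorForm_tmul, CStarModule.inner_sum_left,
      CStarModule.inner_sum_right, hH, M.inner_left]
    refine Eq.trans ?_ Finset.sum_comm
    refine Finset.sum_congr rfl fun i _ => ?_
    refine Eq.trans ?_ Finset.sum_comm
    refine Finset.sum_congr rfl fun j _ => ?_
    refine Finset.sum_congr rfl fun p _ => ?_
    rw [map_mul, Module.End.mul_apply]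
  rw [h]
  exact Finset.sum_nonneg fun p _ => CStarModule.inner_self_nonneg

/-- The algebraic tensor product with its semi-inner product and the right action
`(x ⊗ m) · f = x ⊗ (m · f)`. -/
def preTensor : PreHilbMod K where
  carrier := M.carrier ⊗[ℂ] X.carrier
  form s t := X.tensorForm M s t
  form_add s t t' := map_add _ _ _
  form_smul f s t := by
    induction t with
    | zero => simp
    | add t t' ht ht' => rw [smul_add, map_add, map_add, ht, ht', mul_add]
    | tmul n y =>
      induction s with
      | zero => simp
      | add s s' hs hs' => rw [map_add, LinearMap.add_apply, LinearMap.add_apply, hs, hs', mul_add]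
      | tmul m x =>
        rw [TensorProduct.smul_tmul', tensorForm_tmul, tensorForm_tmul, map_smul,
          CStarModule.inner_op_smul_right]
  star_form := X.star_tensorForm M
  form_self_nonneg := X.tensorForm_self_nonneg M

/-- The internal tensor product `X ⊗_A M` of a Hilbert module and a correspondence over
`A = C(K, ℂ)`. -/
def tensor : HilbMod K := (X.preTensor M).completion

/-- The elementary tensor `x ⊗ m` in `X ⊗_A M`. -/
def tmul (x : X) (m : M.carrier) : X.tensor M :=
  (X.preTensor M).toCompletion (show M.carrier ⊗[ℂ] X.carrier from m ⊗ₜ x)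

end HilbMod

namespace Corr

variable (M N : Corr K)

/-- The left action `f · (m ⊗ n) = (f · m) ⊗ n` on the algebraic tensor product. -/
def preTensorLeft : C(K, ℂ) →ₐ[ℂ] Module.End C(K, ℂ) (N.carrier ⊗[ℂ] M.carrier) :=
  AlgHom.ofLinearMap
    (TensorProduct.AlgebraTensorModule.lTensor C(K, ℂ) N.carrier ∘ₗ
      { toFun := fun f => (M.left f).restrictScalars ℂ
        map_add' := fun f g => by rw [map_add]; rfl
        map_smul' := fun z f => by rw [map_smul]; rfl })
    (by
      refine TensorProduct.AlgebraTensorModule.ext fun n m => ?_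
      simp)
    (fun f g => by
      refine TensorProduct.AlgebraTensorModule.ext fun n m => ?_
      simp)

@[simp] lemma preTensorLeft_tmul (f : C(K, ℂ)) (n : N.carrier) (m : M.carrier) :
    M.preTensorLeft N f (n ⊗ₜ m) = n ⊗ₜ (M.left f m) := rfl

lemma tensorForm_left (f : C(K, ℂ)) (s t : N.carrier ⊗[ℂ] M.carrier) :
    M.toHilbMod.tensorForm N (M.preTensorLeft N f s) t =
      M.toHilbMod.tensorForm N s (M.preTensorLeft N (star f) t) := by
  induction t with
  | zero => simp
  | add t t' ht ht' => rw [map_add, map_add, map_add, ht, ht']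
  | tmul n m =>
    induction s with
    | zero => simp
    | add s s' hs hs' => simp only [map_add, LinearMap.add_apply, hs, hs']
    | tmul n' m' =>
      simp only [preTensorLeft_tmul, HilbMod.tensorForm_tmul, M.inner_left]

/-- The algebraic tensor product of two correspondences. -/
def preTensor : PreCorr K where
  toPreHilbMod := M.toHilbMod.preTensor N
  left := M.preTensorLeft N
  form_left := M.tensorForm_left N

/-- The internal tensor product `M ⊗_A N` of two correspondences. Its underlying Hilbert module is
`M.toHilbMod.tensor N`. -/
def tensor : Corr K := (M.preTensor N).completion

/-- The correspondence `A_A` over `A = C(K, ℂ)`, with `⟨f, g⟩ = f* g`. -/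
def self (K : Type u) [TopologicalSpace K] [CompactSpace K] : Corr K where
  carrier := C(K, ℂ)
  left := (Algebra.lmul C(K, ℂ) C(K, ℂ)).restrictScalars ℂ
  inner_left f x y := by
    simp only [WithCStarModule.inner_def]
    simp
    ring

/-- The tensor powers `M^{⊗ k}`, with `M^{⊗ 0} = A_A` and `M^{⊗ (k + 1)} = M ⊗_A M^{⊗ k}`. -/
def pow : ℕ → Corr K
  | 0 => Corr.self K
  | k + 1 => M.tensor (pow k)

/-- A filter in `M`. -/
def IsFilter (m : M.carrier) : Prop := inner C(K, ℂ) m m = 1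

/-- The map `n ↦ m ⊗ n` from `N` to `M ⊗_A N`. -/
def tmulLeft (m : M.carrier) : N.carrier →ₗ[C(K, ℂ)] (M.toHilbMod.tensor N).carrier where
  toFun n := M.toHilbMod.tmul N m n
  map_add' n n' :=
    (congrArg (M.toHilbMod.preTensor N).toCompletion (TensorProduct.add_tmul n n' m)).trans
      (map_add (M.toHilbMod.preTensor N).toCompletion (n ⊗ₜ[ℂ] m) (n' ⊗ₜ[ℂ] m))
  map_smul' f n := map_smul (M.toHilbMod.preTensor N).toCompletion f (n ⊗ₜ[ℂ] m)

lemma inner_tmulLeft (m : M.carrier) (hm : M.IsFilter m) (n n' : N.carrier) :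
    inner C(K, ℂ) (M.tmulLeft N m n) (M.tmulLeft N m n') = inner C(K, ℂ) n n' := by
  refine (PreHilbMod.completion_inner_coe _ _ _).trans ?_
  change inner C(K, ℂ) n (N.left (inner C(K, ℂ) m m) n') = _
  rw [show inner C(K, ℂ) m m = 1 from hm, map_one, Module.End.one_apply]

end Corr

/-- A direct system of Hilbert modules `X 0 → X 1 → ⋯` with inner-product preserving maps. -/
structure HilbSystem (K : Type u) [TopologicalSpace K] [CompactSpace K] where
  X : ℕ → HilbMod K
  T : ∀ k, (X k).carrier →ₗ[C(K, ℂ)] (X (k + 1)).carrier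
  inner_T : ∀ k x y, inner C(K, ℂ) (T k x) (T k y) = inner C(K, ℂ) x y

namespace HilbSystem

variable (S : HilbSystem K)

/-- The composite `X i → X j` for `i ≤ j`. -/
def map (i j : ℕ) (h : i ≤ j) : (S.X i).carrier →ₗ[C(K, ℂ)] (S.X j).carrier :=
  Nat.leRec (motive := fun n _ => (S.X i).carrier →ₗ[C(K, ℂ)] (S.X n).carrier) LinearMap.id
    (fun n _ f => S.T n ∘ₗ f) h

lemma map_self (i : ℕ) (x : S.X i) : S.map i i le_rfl x = x := by
  rw [map, Nat.leRec_self]; rfl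

lemma map_succ (i j : ℕ) (h : i ≤ j) (x : S.X i) :
    S.map i (j + 1) (h.trans j.le_succ) x = S.T j (S.map i j h x) := by
  rw [map, Nat.leRec_succ _ _ h]; rfl

instance : DirectedSystem (fun k => (S.X k).carrier) (fun i j h => S.map i j h) where
  map_self i x := S.map_self i x
  map_map k j i hij hjk x := by
    induction k, hjk using Nat.le_induction with
    | base => rw [S.map_self]
    | succ n hn ih => rw [S.map_succ j n hn, S.map_succ i n (hij.trans hn), ih]

lemma inner_map (i j : ℕ) (h : i ≤ j) (x y : S.X i) :
    inner C(K, ℂ) (S.map i j h x) (S.map i j h y) = inner C(K, ℂ) x y := by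
  induction j, h using Nat.le_induction with
  | base => rw [S.map_self, S.map_self]
  | succ n hn ih => rw [S.map_succ i n hn, S.map_succ i n hn, S.inner_T, ih]

/-- The algebraic direct limit (the disjoint union of the `X k` modulo the identifications
`x ∼ T k x`) with its inner product. -/
def preLim : PreHilbMod K where
  carrier := DirectLimit (fun k => (S.X k).carrier) S.map
  moduleC := Module.compHom _ (algebraMap ℂ C(K, ℂ))
  isScalarTower := by
    let := Module.compHom (DirectLimit (fun k => (S.X k).carrier) S.map) (algebraMap ℂ C(K, ℂ))
    exact IsScalarTower.of_algebraMap_smul fun z x => rfl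
  form := DirectLimit.lift₂ S.map S.map (fun _ x y => inner C(K, ℂ) x y)
    (fun i j h x y => (S.inner_map i j h x y).symm)
  form_add := DirectLimit.induction₃ _ fun i x y z => by
    rw [DirectLimit.add_def]
    simp only [DirectLimit.lift₂_def, CStarModule.inner_add_right]
  form_smul f := DirectLimit.induction₂ _ fun i x y => by
    rw [DirectLimit.smul_def]
    simp only [DirectLimit.lift₂_def, CStarModule.inner_op_smul_right]
  star_form := DirectLimit.induction₂ _ fun i x y => by
    simp only [DirectLimit.lift₂_def, CStarModule.star_inner]
  form_self_nonneg := DirectLimit.induction _ fun i x => by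
    simp only [DirectLimit.lift₂_def]
    exact CStarModule.inner_self_nonneg

/-- The direct limit of the system: the completion of the algebraic direct limit. -/
def lim : HilbMod K := S.preLim.completion

/-- The canonical map `ι^k : X k → lim X`. -/
def ι (k : ℕ) : (S.X k).carrier →ₗ[C(K, ℂ)] S.lim.carrier :=
  S.preLim.toCompletion ∘ₗ DirectLimit.Module.of C(K, ℂ) ℕ (fun k => (S.X k).carrier) S.map k

end HilbSystem

/-- The direct system `(M^{⊗ k}, T_k)` with `T_k n = m ⊗ n` associated to a filter `m`. -/
def Corr.filterSystem (M : Corr K) (m : M.carrier) (hm : M.IsFilter m) : HilbSystem K where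
  X k := (M.pow k).toHilbMod
  T k := M.tmulLeft (M.pow k) m
  inner_T k := M.inner_tmulLeft (M.pow k) m hm

/-- An isomorphism of Hilbert modules: an inner-product preserving module isomorphism. -/
structure HilbMod.Iso (X Y : HilbMod K) extends X.carrier ≃ₗ[C(K, ℂ)] Y.carrier where
  inner_map : ∀ x y, inner C(K, ℂ) (toFun x) (toFun y) = inner C(K, ℂ) x y

/-- With `D : X → X ⊗_A M` an isomorphism, `(X, D, φ)` is a scaling function for `m ∈ M`. -/
def IsScalingFunction (M : Corr K) (m : M.carrier) (X : HilbMod K) (D : X.Iso (X.tensor M))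
    (φ : X) : Prop :=
  inner C(K, ℂ) φ φ = 1 ∧ D.toFun φ = X.tmul M φ m

/-- `V` is a closed submodule of `W` and `(m, n) ↦ m + n` maps `V ⊕ (W ∩ V^⊥)` onto `W`. -/
def HilbMod.IsComplementedIn (X : HilbMod K) (V W : Submodule C(K, ℂ) X.carrier) : Prop :=
  V ≤ W ∧ IsClosed (V : Set X.carrier) ∧
    ∀ x ∈ W, ∃ m ∈ V, ∃ n ∈ W, (∀ v ∈ V, inner C(K, ℂ) v n = 0) ∧ x = m + n

/-- A projective multi-resolution analysis for `X` with respect to a dilation `D : X → X`. -/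
structure IsProjectiveMRA (X : HilbMod K) (D : X.carrier → X.carrier)
    (V : ℕ → Submodule C(K, ℂ) X.carrier) : Prop where
  complemented_zero : X.IsComplementedIn (V 0) ⊤
  eq_preimage : ∀ k, (V k : Set X.carrier) = D^[k] ⁻¹' (V 0)
  complemented_succ : ∀ k, X.IsComplementedIn (V k) (V (k + 1))
  dense : Dense (⋃ k, (V k : Set X.carrier))

/-- An endomorphism `α` of `C(K, ℂ)` together with a transfer operator `L` for it. -/
structure TransferOperator (K : Type u) [TopologicalSpace K] [CompactSpace K] where
  α : C(K, ℂ) →⋆ₐ[ℂ] C(K, ℂ)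
  L : C(K, ℂ) →ₗ[ℂ] C(K, ℂ)
  nonneg : ∀ f, 0 ≤ f → 0 ≤ L f
  apply_mul : ∀ f g, L (f * α g) = L f * g

namespace TransferOperator

variable (τ : TransferOperator K)

lemma star_apply (f : C(K, ℂ)) : star (τ.L f) = τ.L (star f) := by
  obtain ⟨y, hy, -, hf⟩ := CStarAlgebra.exists_sum_four_nonneg f
  rw [hf]
  simp only [map_sum, map_smul, star_sum, star_smul, (IsSelfAdjoint.of_nonneg (hy _)).star_eq,
    (IsSelfAdjoint.of_nonneg (τ.nonneg _ (hy _))).star_eq]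

/-- The vector space `A_L = C(K, ℂ)` underlying Exel's correspondence. -/
def ExelSpace (_ : TransferOperator K) : Type u := C(K, ℂ)

instance : AddCommGroup τ.ExelSpace := inferInstanceAs (AddCommGroup C(K, ℂ))
instance : Module ℂ τ.ExelSpace := inferInstanceAs (Module ℂ C(K, ℂ))

/-- The right action `x · f = x α(f)`. -/
instance : Module C(K, ℂ) τ.ExelSpace :=
  Module.compHom C(K, ℂ) (τ.α : C(K, ℂ) →+* C(K, ℂ))

lemma exelSpace_smul_def (f : C(K, ℂ)) (x : τ.ExelSpace) :
    f • x = (show τ.ExelSpace from τ.α f * (show C(K, ℂ) from x)) := rfl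

instance : IsScalarTower ℂ C(K, ℂ) τ.ExelSpace where
  smul_assoc z f x := by
    change τ.α (z • f) * (show C(K, ℂ) from x) = z • (τ.α f * (show C(K, ℂ) from x))
    rw [map_smul, smul_mul_assoc]

/-- The left action of `C(K, ℂ)` on `A_L` by multiplication. -/
def exelLeft : C(K, ℂ) →ₐ[ℂ] Module.End C(K, ℂ) τ.ExelSpace where
  toFun f :=
    { toFun := fun x => (show τ.ExelSpace from f * (show C(K, ℂ) from x))
      map_add' := fun x y => mul_add (R := C(K, ℂ)) f x y
      map_smul' := fun g x => mul_left_comm (G := C(K, ℂ)) f (τ.α g) x }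
  map_one' := LinearMap.ext fun x => one_mul (M := C(K, ℂ)) x
  map_mul' f g := LinearMap.ext fun x => mul_assoc (G := C(K, ℂ)) f g x
  map_zero' := LinearMap.ext fun x => zero_mul (M₀ := C(K, ℂ)) x
  map_add' f g := LinearMap.ext fun x => add_mul (R := C(K, ℂ)) f g x
  commutes' z := LinearMap.ext fun x => by
    change algebraMap ℂ C(K, ℂ) z * (show C(K, ℂ) from x) = z • (show C(K, ℂ) from x)
    rw [Algebra.smul_def]

/-- `A_L` with the semi-inner product `⟨x, y⟩ = L(x* y)` and the left action by multiplication. -/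
def preExel : PreCorr K where
  carrier := τ.ExelSpace
  form (x y : C(K, ℂ)) := τ.L (star x * y)
  form_add (x y z : C(K, ℂ)) := by
    change τ.L (star x * (y + z)) = _
    rw [mul_add, map_add]
  form_smul f (x y : C(K, ℂ)) := by
    change τ.L (star x * (τ.α f * y)) = _
    rw [mul_comm (τ.α f), ← mul_assoc, τ.apply_mul, mul_comm]
  star_form (x y : C(K, ℂ)) := by rw [τ.star_apply, star_mul, star_star]
  form_self_nonneg (x : C(K, ℂ)) := τ.nonneg _ (star_mul_self_nonneg x)
  left := τ.exelLeft
  form_left f (x y : C(K, ℂ)) := by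
    change τ.L (star (f * x) * y) = τ.L (star x * (star f * y))
    rw [star_mul, mul_comm (star x), mul_assoc, mul_left_comm]

/-- Exel's correspondence `M_L`, the completion of `A_L`. -/
def exel : Corr K := τ.preExel.completion

/-- The image in `M_L` of an element of `A_L = C(K, ℂ)`. -/
def toExel (f : C(K, ℂ)) : τ.exel.carrier := τ.preExel.toPreHilbMod.toCompletion f

end TransferOperator

end Modules

/-! ### Directed graphs -/

/-- A finite directed graph. -/
structure FinDigraph where
  V : Type u
  E : Type u
  [fintypeV : Fintype V]
  [fintypeE : Fintype E]
  r : E → V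
  s : E → V

namespace FinDigraph

variable (G : FinDigraph.{u})

attribute [instance] FinDigraph.fintypeV FinDigraph.fintypeE

/-- Every vertex receives an edge. -/
def NoSources : Prop := ∀ v, ∃ e, G.r e = v

/-- Every vertex emits an edge. -/
def NoSinks : Prop := ∀ v, ∃ e, G.s e = v

instance : TopologicalSpace G.E := ⊥
instance : DiscreteTopology G.E := ⟨rfl⟩
instance : TopologicalSpace G.V := ⊥
instance : DiscreteTopology G.V := ⟨rfl⟩

/-- The set `s⁻¹(v)` of edges with source `v`. -/
def Out (v : G.V) : Type u := {e : G.E // G.s e = v}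

instance (v : G.V) : Fintype (G.Out v) :=
  letI := Classical.decEq G.V
  inferInstanceAs (Fintype {e : G.E // G.s e = v})
instance (v : G.V) : TopologicalSpace (G.Out v) := ⊥
instance (v : G.V) : DiscreteTopology (G.Out v) := ⟨rfl⟩
instance (v : G.V) : MeasurableSpace (G.Out v) := ⊤
instance (v : G.V) : DiscreteMeasurableSpace (G.Out v) := ⟨fun _ => trivial⟩

/-- The space `E^∞` of right-infinite paths `c₀c₁c₂⋯`, where `s(cᵢ) = r(cᵢ₊₁)`. -/
def InfPath : Type u := {c : ℕ → G.E // ∀ i, G.s (c i) = G.r (c (i + 1))}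

/-- The space `E^(-∞,∞)` of two-sided infinite paths `⋯c₋₁c₀c₁⋯`. -/
def BiPath : Type u := {c : ℤ → G.E // ∀ i, G.s (c i) = G.r (c (i + 1))}

instance : TopologicalSpace G.InfPath := instTopologicalSpaceSubtype
instance : TopologicalSpace G.BiPath := instTopologicalSpaceSubtype
instance : MeasurableSpace G.BiPath := borel _
instance : BorelSpace G.BiPath := ⟨rfl⟩
instance : FirstCountableTopology G.InfPath :=
  (Topology.IsInducing.subtypeVal (t := {c : ℕ → G.E |
    ∀ i, G.s (c i) = G.r (c (i + 1))})).firstCountableTopology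

lemma isClosed_path {I : Type} (next : I → I) :
    IsClosed {c : I → G.E | ∀ i, G.s (c i) = G.r (c (next i))} := by
  rw [Set.ofPred_forall]
  refine isClosed_iInter fun i => isClosed_eq ?_ ?_
  · exact (continuous_of_discreteTopology (f := G.s)).comp (continuous_apply i)
  · exact (continuous_of_discreteTopology (f := G.r)).comp (continuous_apply (next i))

instance : CompactSpace G.InfPath :=
  isCompact_iff_compactSpace.1 (G.isClosed_path (fun i : ℕ => i + 1)).isCompact

instance : CompactSpace G.BiPath :=
  isCompact_iff_compactSpace.1 (G.isClosed_path (fun i : ℤ => i + 1)).isCompact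

/-- The edge of index `i` of a path. -/
def edge (i : ℕ) : C(G.InfPath, G.E) :=
  ⟨fun c => c.1 i, (continuous_apply i).comp continuous_subtype_val⟩

lemma continuous_biEdge (i : ℤ) : Continuous fun d : G.BiPath => d.1 i :=
  (continuous_apply i).comp continuous_subtype_val

lemma continuous_edge (i : ℕ) : Continuous fun c : G.InfPath => c.1 i :=
  (continuous_apply i).comp continuous_subtype_val

/-- The range `r(c) = r(c₀)` of a right-infinite path. -/
def range (c : G.InfPath) : G.V := G.r (c.1 0)

/-- The backward shift `σ(c₀c₁c₂⋯) = c₁c₂⋯` on `E^∞`. -/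
def shift : C(G.InfPath, G.InfPath) where
  toFun c := ⟨fun i : ℕ => c.1 (i + 1), fun i => c.2 (i + 1)⟩
  continuous_toFun := Continuous.subtype_mk
    (continuous_pi fun i : ℕ => G.continuous_edge (i + 1)) _

/-- The path `ec`, for an edge `e` with `s(e) = r(c)`. -/
def cons (e : G.E) (c : G.InfPath) (h : G.s e = G.range c) : G.InfPath :=
  ⟨fun i => Nat.casesOn i e c.1, fun i => by
    cases i with
    | zero => exact h
    | succ n => exact c.2 n⟩

/-- The transfer operator `L(f)(c) = |s⁻¹(r(c))|⁻¹ ∑_{s(e) = r(c)} f(ec)`, as a function. -/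
def transferFun (f : C(G.InfPath, ℂ)) (c : G.InfPath) : ℂ :=
  (Fintype.card (G.Out (G.range c)) : ℂ)⁻¹ *
    ∑ e : G.Out (G.range c), f (G.cons e.1 c e.2)

lemma continuous_range : Continuous G.range :=
  (continuous_of_discreteTopology (f := G.r)).comp
    ((continuous_apply 0).comp continuous_subtype_val)

open Classical in
lemma continuous_transferFun (f : C(G.InfPath, ℂ)) : Continuous (G.transferFun f) := by
  have hF : ∀ e : G.E, Continuous fun c : G.InfPath =>
      if h : G.s e = G.range c then f (G.cons e c h) else 0 := by
    intro e
    have hU : IsOpen {c : G.InfPath | G.s e = G.range c} :=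
      (isOpen_discrete {v : G.V | G.s e = v}).preimage G.continuous_range
    have hU' : IsOpen {c : G.InfPath | ¬ G.s e = G.range c} :=
      (isOpen_discrete {v : G.V | ¬ G.s e = v}).preimage G.continuous_range
    rw [← continuousOn_univ]
    have : (Set.univ : Set G.InfPath) =
        {c | G.s e = G.range c} ∪ {c | ¬ G.s e = G.range c} := by
      ext c; simpa using _root_.em _
    rw [this]
    refine ContinuousOn.union_of_isOpen ?_ ?_ hU hU'
    · rw [continuousOn_iff_continuous_domRestrict]
      have : Continuous fun c : {c : G.InfPath | G.s e = G.range c} =>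
          f (G.cons e c.1 c.2) := by
        refine f.continuous.comp (Continuous.subtype_mk (continuous_pi fun i => ?_) _)
        cases i with
        | zero => exact continuous_const
        | succ n =>
          exact (continuous_apply n).comp (continuous_subtype_val.comp continuous_subtype_val)
      refine this.congr fun c => ?_
      have hc : G.s e = G.range c.1 := c.2
      simp [hc]
    · refine (continuousOn_const (c := (0 : ℂ))).congr fun c hc => ?_
      have hc' : ¬ G.s e = G.range c := hc
      rw [dif_neg hc']
  have h : G.transferFun f = fun c => (Fintype.card (G.Out (G.range c)) : ℂ)⁻¹ *
      ∑ e : G.E, if h : G.s e = G.range c then f (G.cons e c h) else 0 := by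
    ext c
    rw [transferFun]
    congr 1
    rw [← Finset.sum_filter_add_sum_filter_not Finset.univ (fun e => G.s e = G.range c),
      Finset.sum_eq_zero (s := Finset.univ.filter fun e => ¬ G.s e = G.range c), add_zero]
    · refine Finset.sum_bij (fun e _ => e.1) (fun e _ => by simpa using e.2)
        (fun a _ b _ hab => Subtype.ext hab)
        (fun e he => ⟨⟨e, by simpa using he⟩, Finset.mem_univ _, rfl⟩) fun e _ => ?_
      rw [dif_pos e.2]
    · intro e he
      rw [dif_neg (by simpa using he)]
  rw [h]
  refine Continuous.mul ?_ (continuous_finsetSum _ fun e _ => hF e)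
  exact (continuous_of_discreteTopology
    (f := fun v : G.V => (Fintype.card (G.Out v) : ℂ)⁻¹)).comp G.continuous_range

/-- The system `(C(E^∞), α, L)` associated to the backward shift, where `α(f) = f ∘ σ`. -/
def transfer : TransferOperator G.InfPath where
  α := ContinuousMap.compStarAlgHom' ℂ ℂ G.shift
  L :=
    { toFun := fun f => ⟨G.transferFun f, G.continuous_transferFun f⟩
      map_add' := fun f g => by
        ext c
        simp [transferFun, Finset.sum_add_distrib, mul_add]
      map_smul' := fun z f => by
        ext c
        simp [transferFun, ← Finset.mul_sum, mul_left_comm] }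
  nonneg f hf c := by
    refine mul_nonneg (inv_nonneg.2 (Nat.cast_nonneg _)) (Finset.sum_nonneg fun e _ => ?_)
    exact hf _
  apply_mul f g := by
    ext c
    have h : ∀ e : G.Out (G.range c), G.shift (G.cons e.1 c e.2) = c :=
      fun e => Subtype.ext (funext fun i => rfl)
    simp [transferFun, h, ← Finset.sum_mul, mul_assoc]

/-- The characteristic function of the cylinder set `Z(e) = {c | c₀ = e}`. -/
def cylinder (e : G.E) : C(G.InfPath, ℂ) :=
  ContinuousMap.comp ⟨Set.indicator {e} 1, continuous_of_discreteTopology⟩ (G.edge 0)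

/-- The function `m = ∑ₑ w(e) χ_{Z(e)}`. -/
def filterFun (w : G.E → ℂ) : C(G.InfPath, ℂ) := ∑ e, w e • G.cylinder e

/-- The projection of `E^(-∞,∞)` onto `E^[-k,∞)`, which is identified with `E^∞` by renumbering the
edges: `⋯c₋₁c₀c₁⋯` is sent to `c₋ₖc₋ₖ₊₁⋯`. For `k = 0` this is the projection onto `E^∞`. -/
def proj (k : ℕ) : C(G.BiPath, G.InfPath) where
  toFun d := ⟨fun i : ℕ => d.1 (i - k), fun i => by
    have h : (i : ℤ) - k + 1 = ((i + 1 : ℕ) : ℤ) - k := by push_cast; ring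
    rw [d.2 (i - k), h]⟩
  continuous_toFun := Continuous.subtype_mk
    (continuous_pi fun i : ℕ => G.continuous_biEdge (i - k)) _

/-- The backward shift `h` on `E^(-∞,∞)`. -/
def biShift : G.BiPath ≃ₜ G.BiPath where
  toFun d := ⟨fun i : ℤ => d.1 (i + 1), fun i => d.2 (i + 1)⟩
  invFun d := ⟨fun i : ℤ => d.1 (i - 1), fun i => by
    have h : i - 1 + 1 = i + 1 - 1 := by ring
    rw [d.2 (i - 1), h]⟩
  left_inv d := Subtype.ext <| funext fun i => by simp
  right_inv d := Subtype.ext <| funext fun i => by simp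
  continuous_toFun := Continuous.subtype_mk
    (continuous_pi fun i : ℤ => G.continuous_biEdge (i + 1)) _
  continuous_invFun := Continuous.subtype_mk
    (continuous_pi fun i : ℤ => G.continuous_biEdge (i - 1)) _

/-! ### The measures on the fibres of `E^(-∞,∞) → E^∞` -/

open MeasureTheory

/-- A choice, for each `n` and each vertex `v`, of an edge with source `v`. -/
def Choice : Type u := (p : ℕ × G.V) → G.Out p.2

instance : TopologicalSpace G.Choice :=
  inferInstanceAs (TopologicalSpace ((p : ℕ × G.V) → G.Out p.2))
instance : MeasurableSpace G.Choice :=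
  inferInstanceAs (MeasurableSpace ((p : ℕ × G.V) → G.Out p.2))
instance (v : G.V) : BorelSpace (G.Out v) := ⟨borel_eq_top_of_discrete.symm⟩
instance : OpensMeasurableSpace G.Choice :=
  inferInstanceAs (OpensMeasurableSpace ((p : ℕ × G.V) → G.Out p.2))

/-- The measure on `s⁻¹(v)` which gives an edge `e` the mass `|w(e)|² |s⁻¹(v)|⁻¹`. -/
def edgeMeasure (w : G.E → ℂ) (v : G.V) : Measure (G.Out v) :=
  ∑ e : G.Out v, ENNReal.ofReal (‖w e.1‖ ^ 2 / Fintype.card (G.Out v)) • Measure.dirac e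

/-- The law of a family of independent random choices. -/
def choiceMeasure (w : G.E → ℂ) : Measure G.Choice :=
  Measure.infinitePi fun p : ℕ × G.V => G.edgeMeasure w p.2

instance (w : G.E → ℂ) : IsFiniteMeasure (G.choiceMeasure w) := by
  by_cases h : ∀ p : ℕ × G.V, IsProbabilityMeasure (G.edgeMeasure w p.2)
  · have : IsProbabilityMeasure (G.choiceMeasure w) :=
      inferInstanceAs (IsProbabilityMeasure (Measure.infinitePi _))
    infer_instance
  · have : G.choiceMeasure w = 0 := by
      rw [choiceMeasure, Measure.infinitePi, dif_neg h]
      rfl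
    rw [this]
    infer_instance

/-- The edges `c₋₁, c₋₂, …` preceding `c`, read off from a family of choices. -/
def past (ω : G.Choice) (c : G.InfPath) : ℕ → G.E
  | 0 => (ω (0, G.range c)).1
  | n + 1 => (ω (n + 1, G.r (past ω c n))).1

/-- The two-sided path extending `c` whose past is read off from a family of choices. -/
def extend (ω : G.Choice) (c : G.InfPath) : G.BiPath where
  val
    | Int.ofNat n => c.1 n
    | Int.negSucc n => G.past ω c n
  property i := by
    match i with
    | Int.ofNat n => exact c.2 n
    | Int.negSucc 0 => exact (ω (0, G.range c)).2
    | Int.negSucc (n + 1) => exact (ω (n + 1, G.r (G.past ω c n))).2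

lemma proj_extend (ω : G.Choice) (c : G.InfPath) : G.proj 0 (G.extend ω c) = c := by
  refine Subtype.ext (funext fun i => ?_)
  change (G.extend ω c).1 ((i : ℤ) - (0 : ℕ)) = c.1 i
  rw [Nat.cast_zero, sub_zero]
  rfl

lemma continuous_choice (n : ℕ) :
    Continuous fun p : G.Choice × G.V => (p.1 (n, p.2)).1 := by
  rw [continuous_prod_of_discrete_right]
  intro v
  exact (continuous_of_discreteTopology (f := fun e : G.Out v => e.1)).comp
    (continuous_apply ((n, v) : ℕ × G.V))

lemma continuous_past (n : ℕ) :
    Continuous fun p : G.Choice × G.InfPath => G.past p.1 p.2 n := by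
  induction n with
  | zero =>
    exact (G.continuous_choice 0).comp
      (continuous_fst.prodMk (G.continuous_range.comp continuous_snd))
  | succ n ih =>
    exact (G.continuous_choice (n + 1)).comp
      (continuous_fst.prodMk ((continuous_of_discreteTopology (f := G.r)).comp ih))

lemma continuous_extend :
    Continuous fun p : G.Choice × G.InfPath => G.extend p.1 p.2 := by
  refine Continuous.subtype_mk (continuous_pi fun i => ?_) _
  match i with
  | Int.ofNat n => exact (continuous_apply n).comp (continuous_subtype_val.comp continuous_snd)
  | Int.negSucc n => exact G.continuous_past n

lemma continuous_extend_left (c : G.InfPath) : Continuous fun ω => G.extend ω c :=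
  G.continuous_extend.comp (continuous_id.prodMk continuous_const)

/-- The measure `μ^c` on two-sided paths, carried by the fibre over `c ∈ E^∞`: the past of `c` is
chosen at random, an edge `e` with the prescribed source having probability `|w(e)|² |s⁻¹(s(e))|⁻¹`. -/
def pathMeasure (w : G.E → ℂ) (c : G.InfPath) : Measure G.BiPath :=
  (G.choiceMeasure w).map fun ω => G.extend ω c

instance (w : G.E → ℂ) (c : G.InfPath) : IsFiniteMeasure (G.pathMeasure w c) := by
  unfold pathMeasure; infer_instance

/-- `μ` is the probability measure on two-sided paths which is carried by the fibre `π₀⁻¹(c)` and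
satisfies `∫ x ∘ πₖ dμ = ∑_{d} x(d) |wₖ(d)|²` for all `k` and all continuous functions `x` on
`E^[-k,∞)`, where `d` runs over the extensions of `c` in `E^[-k,∞)`. With `E^[-k,∞)` identified with
`E^∞`, these are the `d` with `σᵏ(d) = c`, and `|wₖ(d)|² = ∏_{j < k} |w(dⱼ)|² |s⁻¹(s(dⱼ))|⁻¹`. -/
structure IsFibreMeasure (w : G.E → ℂ) (c : G.InfPath) (μ : Measure G.BiPath) : Prop where
  isProbabilityMeasure : IsProbabilityMeasure μ
  ae_fibre : ∀ᵐ d ∂μ, G.proj 0 d = c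
  integral_proj : ∀ (k : ℕ) (x : C(G.InfPath, ℂ)),
    ∫ d, x (G.proj k d) ∂μ = ∑ᶠ (d : G.InfPath) (_ : G.shift^[k] d = c),
      x d * ((∏ j ∈ Finset.range k,
        ‖w (d.1 j)‖ ^ 2 / Fintype.card (G.Out (G.s (d.1 j))) : ℝ) : ℂ)

lemma integral_pathMeasure (w : G.E → ℂ) (c : G.InfPath) (x : C(G.BiPath, ℂ)) :
    ∫ d, x d ∂G.pathMeasure w c = ∫ ω, x (G.extend ω c) ∂G.choiceMeasure w :=
  integral_map (G.continuous_extend_left c).measurable.aemeasurable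
    x.continuous.aestronglyMeasurable

lemma integrable_pathMeasure (w : G.E → ℂ) (c : G.InfPath) (x : C(G.BiPath, ℂ)) :
    Integrable (fun d => x d) (G.pathMeasure w c) :=
  Integrable.of_bound x.continuous.aestronglyMeasurable ‖x‖
    (Filter.Eventually.of_forall fun d => x.norm_coe_le_norm d)

lemma continuous_integral (w : G.E → ℂ) (x : C(G.BiPath, ℂ)) :
    Continuous fun c => ∫ d, x d ∂G.pathMeasure w c := by
  simp only [G.integral_pathMeasure]
  refine continuous_of_dominated (bound := fun _ => ‖x‖) (fun c => ?_) (fun c => ?_)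
    (integrable_const _) ?_
  · exact (x.continuous.comp (G.continuous_extend_left c)).aestronglyMeasurable
  · exact Filter.Eventually.of_forall fun ω => x.norm_coe_le_norm _
  · exact Filter.Eventually.of_forall fun ω =>
      x.continuous.comp (G.continuous_extend.comp (continuous_const.prodMk continuous_id))

/-- The function `c ↦ ∫ x dμ^c`. -/
def fibreIntegral (w : G.E → ℂ) (x : C(G.BiPath, ℂ)) : C(G.InfPath, ℂ) :=
  ⟨fun c => ∫ d, x d ∂G.pathMeasure w c, G.continuous_integral w x⟩

/-- `C(E^(-∞,∞))` with `(x · f)(d) = x(d) f(π₀(d))` and `⟨x, y⟩(c) = ∫ conj(x) y dμ^c`. -/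
def preBilateral (w : G.E → ℂ) : PreHilbMod G.InfPath where
  carrier := C(G.BiPath, ℂ)
  module := Module.compHom _
    (ContinuousMap.compStarAlgHom' ℂ ℂ (G.proj 0) : C(G.InfPath, ℂ) →+* C(G.BiPath, ℂ))
  isScalarTower := by
    let := Module.compHom C(G.BiPath, ℂ)
      (ContinuousMap.compStarAlgHom' ℂ ℂ (G.proj 0) : C(G.InfPath, ℂ) →+* C(G.BiPath, ℂ))
    refine ⟨fun z f x => ?_⟩
    ext d
    change z * f (G.proj 0 d) * x d = z * (f (G.proj 0 d) * x d)
    rw [mul_assoc]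
  form x y := G.fibreIntegral w (star x * y)
  form_add x y z := by
    ext c
    simp only [fibreIntegral, ContinuousMap.coe_mk, ContinuousMap.add_apply, mul_add]
    exact integral_add (G.integrable_pathMeasure w c (star x * y))
      (G.integrable_pathMeasure w c (star x * z))
  form_smul f x y := by
    ext c
    change ∫ d, (star x * (f.comp (G.proj 0) * y)) d ∂G.pathMeasure w c =
      f c * ∫ d, (star x * y) d ∂G.pathMeasure w c
    rw [G.integral_pathMeasure, G.integral_pathMeasure, ← integral_const_mul]
    refine integral_congr_ae (Filter.Eventually.of_forall fun ω => ?_)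
    simp only [ContinuousMap.mul_apply, ContinuousMap.comp_apply, G.proj_extend]
    ring
  star_form x y := by
    ext c
    change star (∫ d, (star x * y) d ∂G.pathMeasure w c) = ∫ d, (star y * x) d ∂G.pathMeasure w c
    rw [RCLike.star_def, ← integral_conj]
    refine integral_congr_ae (Filter.Eventually.of_forall fun d => ?_)
    simp [mul_comm]
  form_self_nonneg x c := by
    change 0 ≤ ∫ d, (star x * x) d ∂G.pathMeasure w c
    have h : ∀ d, (star x * x) d = ((‖x d‖ ^ 2 : ℝ) : ℂ) := fun d => by
      simp [Complex.conj_mul']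
    simp only [h]
    rw [integral_complex_ofReal]
    exact Complex.zero_le_real.2 (integral_nonneg fun d => by positivity)

/-- The Hilbert module `X_∞(E)`, the completion of `C(E^(-∞,∞))`. -/
def bilateral (w : G.E → ℂ) : HilbMod G.InfPath := (G.preBilateral w).completion

/-- The image in `X_∞(E)` of a continuous function on `E^(-∞,∞)`. -/
def toBilateral (w : G.E → ℂ) (x : C(G.BiPath, ℂ)) : G.bilateral w :=
  (G.preBilateral w).toCompletion x

/-- `(Dx)(c) = m(π₀(c)) x(h(c))` for `x ∈ C(E^(-∞,∞))`. -/
def dilation (w : G.E → ℂ) (x : C(G.BiPath, ℂ)) : C(G.BiPath, ℂ) :=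
  (G.filterFun w).comp (G.proj 0) * x.comp (G.biShift : C(G.BiPath, G.BiPath))

end FinDigraph

end

/-!
The operator `D` is `α`-semilinear and satisfies `L ⟨D x, D y⟩ = ⟨x, y⟩`, and the unit vector
`φ = 1` satisfies the scaling equation `D φ = φ · m`. The identity for `L` holds because `μ^c` is
an average of the shifted measures `μ^{ec}`: the factor `|w(e)|²` of its weights comes from `m`, and
the factor `|s⁻¹(r(c))|⁻¹` from `L`.

All isomorphisms are then obtained by matching inner products on dense families, an inner-product
preserving map being automatically isometric and linear. In `X ⊗ M_L` the vectors `D x ⊗ 1` have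
the inner products `L ⟨D x, D y⟩ = ⟨x, y⟩`. In the direct limit the vectors `ι^k (f ⊗ 1 ⊗ ⋯ ⊗ 1)`
have the same inner products as `D^{-k} (φ · f)`, since both come down to `L^k (f* g)` at a common
level. As `L` is bounded below on positive functions, the vectors `f ⊗ 1 ⊗ ⋯ ⊗ 1` exhaust
`M_L^{⊗ k}`, so `V_k = D^{-k} (φ · A)`. The submodule `φ · A` is complemented because `φ` is a unit
vector, and `V_k` is complemented because `D` respects orthogonality. A continuous function
depending only on the edges from time `-k` on lies in `V_k`, and such functions are dense by the
Stone-Weierstrass theorem.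
-/

noncomputable section

/-! ### Hilbert modules and internal tensor products -/

lemma exists_isometry_of_dist_eq {ι α β : Type*} [PseudoMetricSpace α] [MetricSpace β]
    [CompleteSpace β] {S : ι → α} {T : ι → β} (hS : DenseRange S)
    (h : ∀ i j, dist (S i) (S j) = dist (T i) (T j)) :
    ∃ E : α → β, Isometry E ∧ ∀ i, E (S i) = T i := by
  let : PseudoMetricSpace ι := .induced S inferInstance
  have hSi : IsUniformInducing S := ⟨rfl⟩
  have hT : UniformContinuous T := (Isometry.of_dist_eq fun i j => (h i j).symm).uniformContinuous
  let E := (hSi.isDenseInducing hS).extend T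
  have hE : UniformContinuous E := uniformContinuous_uniformly_extend hSi hS hT
  have hES : ∀ i, E (S i) = T i := uniformly_extend_of_ind hSi hS hT
  refine ⟨E, .of_dist_eq fun x y => ?_, hES⟩
  refine hS.induction_on₂ (p := fun x y => dist (E x) (E y) = dist x y) (isClosed_eq ?_ ?_)
    (fun i j => by rw [hES, hES, h]) x y
  · exact (hE.continuous.comp continuous_fst).dist (hE.continuous.comp continuous_snd)
  · exact continuous_dist

section HilbertModules

variable {K : Type u} [TopologicalSpace K] [CompactSpace K]

namespace HilbMod

section Basic

variable {X Y : HilbMod K}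

lemma norm_smul_le (f : C(K, ℂ)) (x : X) : ‖f • x‖ ≤ ‖f‖ * ‖x‖ := by
  refine le_of_sq_le_sq ?_ (by positivity)
  rw [mul_pow, CStarModule.norm_sq_eq C(K, ℂ) (x := f • x),
    CStarModule.norm_sq_eq C(K, ℂ) (x := x), CStarModule.inner_op_smul_left,
    CStarModule.inner_op_smul_right]
  calc ‖f * inner C(K, ℂ) x x * star f‖
      ≤ ‖f‖ * ‖inner C(K, ℂ) x x‖ * ‖star f‖ := norm_mul₃_le
    _ = ‖f‖ ^ 2 * ‖inner C(K, ℂ) x x‖ := by rw [norm_star]; ring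

instance : IsBoundedSMul C(K, ℂ) X := .of_norm_smul_le norm_smul_le

lemma norm_sub_eq_of_inner_eq {x x' : X} {y y' : Y}
    (h : inner C(K, ℂ) x x = inner C(K, ℂ) y y) (h' : inner C(K, ℂ) x' x' = inner C(K, ℂ) y' y')
    (hl : inner C(K, ℂ) x x' = inner C(K, ℂ) y y') (hr : inner C(K, ℂ) x' x = inner C(K, ℂ) y' y) :
    ‖x - x'‖ = ‖y - y'‖ := by
  rw [CStarModule.norm_eq_sqrt_norm_inner_self (A := C(K, ℂ)) (x := x - x'),
    CStarModule.norm_eq_sqrt_norm_inner_self (A := C(K, ℂ)) (x := y - y')]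
  simp only [CStarModule.inner_sub_left, CStarModule.inner_sub_right, h, h', hl, hr]

/-- An inner-product preserving map of Hilbert modules is automatically linear. -/
def linearMapOfInner (E : X → Y) (hE : ∀ x y, inner C(K, ℂ) (E x) (E y) = inner C(K, ℂ) x y) :
    X.carrier →ₗ[C(K, ℂ)] Y.carrier where
  toFun := E
  map_add' x y := by
    rw [← sub_eq_zero, ← sub_sub, ← CStarModule.inner_self (A := C(K, ℂ))]
    simp only [CStarModule.inner_sub_left, CStarModule.inner_sub_right, hE,
      CStarModule.inner_add_left, CStarModule.inner_add_right]
    abel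
  map_smul' f x := by
    rw [← sub_eq_zero, ← CStarModule.inner_self (A := C(K, ℂ))]
    simp only [CStarModule.inner_sub_left, CStarModule.inner_sub_right, hE,
      CStarModule.inner_op_smul_left, CStarModule.inner_op_smul_right, RingHom.id_apply]
    ring

lemma exists_extension_of_inner_eq {ι : Type*} {S : ι → X} {T : ι → Y} (hS : DenseRange S)
    (h : ∀ i j, inner C(K, ℂ) (S i) (S j) = inner C(K, ℂ) (T i) (T j)) :
    ∃ E : X → Y, Continuous E ∧ (∀ i, E (S i) = T i) ∧
      ∀ x y, inner C(K, ℂ) (E x) (E y) = inner C(K, ℂ) x y := by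
  obtain ⟨E, hE, hES⟩ := exists_isometry_of_dist_eq (T := T) hS fun i j => by
    simpa only [dist_eq_norm] using
      norm_sub_eq_of_inner_eq (h i i) (h j j) (h i j) (h j i)
  refine ⟨E, hE.continuous, hES, fun x y => ?_⟩
  refine hS.induction_on₂ (p := fun x y => inner C(K, ℂ) (E x) (E y) = inner C(K, ℂ) x y)
    (isClosed_eq ?_ ?_) (fun i j => by rw [hES, hES, h]) x y
  · exact CStarModule.continuous_inner.comp
      (hE.continuous.prodMap hE.continuous)
  · exact CStarModule.continuous_inner

lemma exists_iso_of_inner_eq {ι : Type*} {S : ι → X} {T : ι → Y} (hS : DenseRange S)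
    (hT : DenseRange T) (h : ∀ i j, inner C(K, ℂ) (S i) (S j) = inner C(K, ℂ) (T i) (T j)) :
    ∃ I : X.Iso Y, ∀ i, I.toFun (S i) = T i := by
  obtain ⟨E, hE, hES, hEi⟩ := exists_extension_of_inner_eq hS h
  obtain ⟨F, hF, hFT, -⟩ := exists_extension_of_inner_eq hT fun i j => (h i j).symm
  have hFE : Function.LeftInverse F E := congrFun <|
    hS.equalizer (hF.comp hE) continuous_id (funext fun i => by simp [hES, hFT])
  have hEF : Function.RightInverse F E := congrFun <|
    hT.equalizer (hE.comp hF) continuous_id (funext fun i => by simp [hES, hFT])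
  exact ⟨{ linearMapOfInner E hEi with
    invFun := F, left_inv := hFE, right_inv := hEF, inner_map := hEi }, hES⟩

lemma isComplementedIn_span_singleton {φ : X} (hφ : inner C(K, ℂ) φ φ = 1) :
    X.IsComplementedIn (Submodule.span C(K, ℂ) {φ}) ⊤ := by
  have mem_iff : ∀ x : X, x ∈ Submodule.span C(K, ℂ) {φ} ↔ inner C(K, ℂ) φ x • φ = x := fun x => by
    rw [Submodule.mem_span_singleton]
    refine ⟨?_, fun hx => ⟨_, hx⟩⟩
    rintro ⟨f, rfl⟩
    rw [CStarModule.inner_op_smul_right, hφ, mul_one]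
  have hcont : Continuous fun x : X => inner C(K, ℂ) φ x • φ :=
    (CStarModule.continuous_inner.comp (Continuous.prodMk_right φ)).smul continuous_const
  refine ⟨le_top, ?_, fun x _ => ⟨inner C(K, ℂ) φ x • φ,
    Submodule.smul_mem _ _ (Submodule.mem_span_singleton_self φ), x - inner C(K, ℂ) φ x • φ,
    trivial, fun v hv => ?_, (add_sub_cancel _ _).symm⟩⟩
  · rw [Set.ext mem_iff]
    exact isClosed_eq hcont continuous_id
  · obtain ⟨f, rfl⟩ := Submodule.mem_span_singleton.1 hv
    rw [CStarModule.inner_op_smul_left, CStarModule.inner_sub_right,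
      CStarModule.inner_op_smul_right, hφ, mul_one, sub_self, zero_mul]

end Basic

end HilbMod

namespace Corr

variable (M : Corr K)

lemma norm_left_le (f : C(K, ℂ)) (x : M.carrier) : ‖M.left f x‖ ≤ ‖f‖ * ‖x‖ := by
  let P : PreCorr K :=
    { carrier := M.carrier
      form := inner C(K, ℂ)
      form_add := fun _ _ _ => CStarModule.inner_add_right
      form_smul := fun _ _ _ => CStarModule.inner_op_smul_right
      star_form := fun _ _ => CStarModule.star_inner _ _
      form_self_nonneg := fun _ => CStarModule.inner_self_nonneg
      left := M.left
      form_left := M.inner_left }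
  have h := P.norm_left_le f x
  rwa [P.toPreHilbMod.norm_def, P.toPreHilbMod.norm_def,
    ← CStarModule.norm_eq_sqrt_norm_inner_self, ← CStarModule.norm_eq_sqrt_norm_inner_self] at h

end Corr

namespace HilbMod

section Tensor

variable {X : HilbMod K} {M : Corr K}

lemma inner_tmul (x y : X) (m n : M.carrier) :
    inner C(K, ℂ) (X.tmul M x m) (X.tmul M y n) =
      inner C(K, ℂ) m (M.left (inner C(K, ℂ) x y) n) :=
  PreHilbMod.completion_inner_coe _ _ _

lemma smul_tmul (f : C(K, ℂ)) (x : X) (m : M.carrier) :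
    X.tmul M (f • x) m = X.tmul M x (M.left f m) := by
  rw [← sub_eq_zero, ← CStarModule.inner_self (A := C(K, ℂ))]
  simp only [CStarModule.inner_sub_left, CStarModule.inner_sub_right, inner_tmul,
    CStarModule.inner_op_smul_right, CStarModule.inner_op_smul_left,
    M.inner_left, ← Module.End.mul_apply, ← map_mul]
  simp only [mul_comm, sub_self]

lemma norm_tmul_le (x : X) (m : M.carrier) : ‖X.tmul M x m‖ ≤ ‖x‖ * ‖m‖ := by
  refine le_of_sq_le_sq ?_ (by positivity)
  rw [CStarModule.norm_sq_eq C(K, ℂ), inner_tmul]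
  calc _ ≤ ‖m‖ * ‖M.left (inner C(K, ℂ) x x) m‖ := CStarModule.norm_inner_le _
    _ ≤ ‖m‖ * (‖inner C(K, ℂ) x x‖ * ‖m‖) := by gcongr; exact M.norm_left_le _ _
    _ = (‖x‖ * ‖m‖) ^ 2 := by rw [← CStarModule.norm_sq_eq C(K, ℂ)]; ring

variable (X M) in
/-- The elementary tensor `x ⊗ m` as a continuous bilinear function of `x` and `m`. -/
def tmulL : X.carrier →L[ℂ] M.carrier →L[ℂ] (X.tensor M).carrier :=
  LinearMap.mkContinuous₂
    ((TensorProduct.mk ℂ M.carrier X.carrier).flip.compr₂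
      ((X.preTensor M).toCompletion.restrictScalars ℂ)) 1
    fun x m => by rw [one_mul]; exact norm_tmul_le x m

lemma dense_of_tmul_mem {ι κ : Type*} {S : ι → X} {T : κ → M.carrier} (hS : DenseRange S)
    (hT : DenseRange T) (W : Submodule ℂ (X.tensor M).carrier)
    (hW : ∀ i j, X.tmul M (S i) (T j) ∈ W) : Dense (W : Set (X.tensor M).carrier) := by
  have htmul : ∀ p : X × M.carrier, X.tmul M p.1 p.2 ∈ W.topologicalClosure := fun p =>
    (hS.prodMap hT).induction_on p
      (W.isClosed_topologicalClosure.preimage (X.tmulL M).continuous₂)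
      fun q => W.le_topologicalClosure (hW q.1 q.2)
  have halg : ∀ t : M.carrier ⊗[ℂ] X.carrier,
      (X.preTensor M).toCompletion t ∈ W.topologicalClosure := fun t => by
    change t ∈ W.topologicalClosure.comap ((X.preTensor M).toCompletion.restrictScalars ℂ)
    induction t with
    | zero => exact zero_mem _
    | add s t hs ht => exact add_mem hs ht
    | tmul m x => exact htmul (x, m)
  exact fun t => Completion.denseRange_coe.induction_on (p := (· ∈ W.topologicalClosure)) t
    W.isClosed_topologicalClosure halg

end Tensor

end HilbMod

lemma Corr.left_tmul (M N : Corr K) (f : C(K, ℂ)) (x : M.carrier) (y : N.carrier) :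
    (M.tensor N).left f (M.toHilbMod.tmul N x y) = M.toHilbMod.tmul N (M.left f x) y :=
  (M.preTensor N).leftCompletion_coe f _

end HilbertModules

/-! ### The tensor powers of `M_L` -/

section TensorPowers

variable {K : Type u} [TopologicalSpace K] [CompactSpace K]

lemma PreHilbMod.denseRange_toCompletion (P : PreHilbMod K) : DenseRange P.toCompletion :=
  Completion.denseRange_coe

lemma PreHilbMod.norm_toCompletion_le {P : PreHilbMod K} {x y : P.carrier} {C : NNReal}
    (h : ‖P.form x x‖ ≤ C * ‖P.form y y‖) :
    ‖P.toCompletion x‖ ≤ √C * ‖P.toCompletion y‖ := by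
  refine (Completion.norm_coe x).trans_le (le_of_le_of_eq ?_
    (congrArg _ (Completion.norm_coe y).symm))
  rw [P.norm_def, P.norm_def, ← Real.sqrt_mul C.coe_nonneg]
  exact Real.sqrt_le_sqrt h

namespace TransferOperator

variable (τ : TransferOperator K)

lemma exists_norm_L_le : ∃ C : NNReal, ∀ f, ‖τ.L f‖ ≤ C * ‖f‖ :=
  (PositiveLinearMap.mk₀ τ.L τ.nonneg).exists_norm_apply_le

lemma continuous_L : Continuous τ.L := by
  obtain ⟨C, hC⟩ := τ.exists_norm_L_le
  exact AddMonoidHomClass.continuous_of_bound τ.L C hC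

lemma inner_toExel (f g : C(K, ℂ)) :
    inner C(K, ℂ) (τ.toExel f) (τ.toExel g) = τ.L (star f * g) :=
  PreHilbMod.completion_inner_coe _ _ _

lemma denseRange_toExel : DenseRange τ.toExel :=
  τ.preExel.toPreHilbMod.denseRange_toCompletion

lemma left_toExel (f g : C(K, ℂ)) : τ.exel.left f (τ.toExel g) = τ.toExel (f * g) :=
  τ.preExel.leftCompletion_coe f _

lemma smul_toExel (f g : C(K, ℂ)) : f • τ.toExel g = τ.toExel (τ.α f * g) :=
  (map_smul τ.preExel.toPreHilbMod.toCompletion f _).symm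

/-- The vector `1 ⊗ ⋯ ⊗ 1` of `M_L^{⊗ k}`. -/
def powOne : ∀ k, (τ.exel.pow k).carrier
  | 0 => (1 : C(K, ℂ))
  | k + 1 => τ.exel.toHilbMod.tmul (τ.exel.pow k) (τ.toExel 1) (powOne k)

/-- The vector `f · (1 ⊗ ⋯ ⊗ 1)` of `M_L^{⊗ k}`. -/
def toPow (k : ℕ) : C(K, ℂ) →ₗ[ℂ] (τ.exel.pow k).carrier where
  toFun f := (τ.exel.pow k).left f (τ.powOne k)
  map_add' f g := by rw [map_add, LinearMap.add_apply]
  map_smul' z f := by rw [map_smul, LinearMap.smul_apply, RingHom.id_apply]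

lemma toPow_succ (k : ℕ) (f : C(K, ℂ)) :
    τ.toPow (k + 1) f = τ.exel.toHilbMod.tmul (τ.exel.pow k) (τ.toExel f) (τ.powOne k) :=
  (Corr.left_tmul _ _ _ _ _).trans (by rw [left_toExel, mul_one])

lemma tmul_toPow (k : ℕ) (f g : C(K, ℂ)) :
    τ.exel.toHilbMod.tmul (τ.exel.pow k) (τ.toExel f) (τ.toPow k g) =
      τ.toPow (k + 1) (f * τ.α g) := by
  rw [toPow_succ, mul_comm, ← smul_toExel, HilbMod.smul_tmul]
  rfl

lemma inner_powOne_toPow (k : ℕ) (f : C(K, ℂ)) :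
    inner C(K, ℂ) (τ.powOne k) (τ.toPow k f) = τ.L^[k] f := by
  induction k generalizing f with
  | zero =>
    change f * 1 * star 1 = f
    rw [star_one, mul_one, mul_one]
  | succ k ih =>
    rw [toPow_succ]
    refine (HilbMod.inner_tmul _ _ _ _).trans ?_
    rw [inner_toExel, star_one, one_mul]
    exact ih _

lemma inner_toPow (k : ℕ) (f g : C(K, ℂ)) :
    inner C(K, ℂ) (τ.toPow k f) (τ.toPow k g) = τ.L^[k] (star f * g) := by
  rw [← inner_powOne_toPow]
  change inner C(K, ℂ) ((τ.exel.pow k).left f _) ((τ.exel.pow k).left g _) =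
    inner C(K, ℂ) _ ((τ.exel.pow k).left _ _)
  rw [Corr.inner_left, map_mul, Module.End.mul_apply]

lemma denseRange_toPow (k : ℕ) : DenseRange (τ.toPow k) := by
  induction k with
  | zero => exact Function.Surjective.denseRange fun f => ⟨f, mul_one (M := C(K, ℂ)) f⟩
  | succ k ih =>
    exact HilbMod.dense_of_tmul_mem τ.denseRange_toExel ih (LinearMap.range (τ.toPow (k + 1)))
      fun f g => ⟨_, (τ.tmul_toPow k f g).symm⟩

/-- `L` is bounded below on positive functions. For such `L` no completion takes place in the
tensor powers of `M_L`. -/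
def IsBoundedBelow : Prop := ∃ C : NNReal, ∀ f : C(K, ℂ), 0 ≤ f → ‖f‖ ≤ C * ‖τ.L f‖

variable {τ}

lemma IsBoundedBelow.iterate (hτ : τ.IsBoundedBelow) (k : ℕ) :
    ∃ C : NNReal, ∀ f : C(K, ℂ), 0 ≤ f → ‖f‖ ≤ C * ‖τ.L^[k] f‖ := by
  obtain ⟨C, hC⟩ := hτ
  refine ⟨C ^ k, ?_⟩
  induction k with
  | zero => simp
  | succ k ih =>
    intro f hf
    calc ‖f‖ ≤ C * ‖τ.L f‖ := hC f hf
      _ ≤ C * ((C ^ k : NNReal) * ‖τ.L^[k] (τ.L f)‖) := by gcongr; exact ih _ (τ.nonneg f hf)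
      _ = (C ^ (k + 1) : NNReal) * ‖τ.L^[k + 1] f‖ := by
        rw [Function.iterate_succ_apply]; push_cast; ring

lemma IsBoundedBelow.surjective_toPow (hτ : τ.IsBoundedBelow) (k : ℕ) :
    Function.Surjective (τ.toPow k) := by
  obtain ⟨C, hC⟩ := hτ.iterate k
  have hbelow : ∀ f, ‖f‖ ≤ NNReal.sqrt C * ‖τ.toPow k f‖ := fun f => by
    refine le_of_sq_le_sq ?_ (by positivity)
    rw [mul_pow, CStarModule.norm_sq_eq C(K, ℂ) (x := τ.toPow k f), inner_toPow, sq ‖f‖,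
      ← CStarRing.norm_star_mul_self]
    simpa using hC _ (star_mul_self_nonneg f)
  have habove : UniformContinuous (τ.toPow k) :=
    AddMonoidHomClass.uniformContinuous_of_bound _ ‖τ.powOne k‖ fun f =>
      ((τ.exel.pow k).norm_left_le f _).trans_eq (mul_comm _ _)
  have hclosed : IsClosed (Set.range (τ.toPow k)) :=
    (AddMonoidHomClass.antilipschitz_of_bound _ hbelow).isClosed_range habove
  rw [← Set.range_eq_univ, ← hclosed.closure_eq]
  exact (τ.denseRange_toPow k).closure_range

end TransferOperator

end TensorPowers

/-! ### Dilations of a transfer operator -/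

lemma apply_add_iterate {α β : Type*} {F : ℕ → α → β} {a : α → α}
    (h : ∀ k x, F (k + 1) (a x) = F k x) (k n : ℕ) (x : α) : F (k + n) (a^[n] x) = F k x := by
  induction n with
  | zero => rfl
  | succ n ih => rw [Function.iterate_succ_apply', ← add_assoc, h, ih]

section Dilations

variable {K : Type u} [TopologicalSpace K] [CompactSpace K]

namespace HilbSystem

variable (S : HilbSystem K)

lemma inner_ι (k : ℕ) (x y : S.X k) :
    inner C(K, ℂ) (S.ι k x) (S.ι k y) = inner C(K, ℂ) x y := by
  refine (PreHilbMod.completion_inner_coe _ _ _).trans ?_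
  unfold preLim
  exact DirectLimit.lift₂_def _ _ (fun k (x y : S.X k) => inner C(K, ℂ) x y)
    (fun i j h x y => (S.inner_map i j h x y).symm) k x y

lemma isometry_ι (k : ℕ) : Isometry (S.ι k) :=
  AddMonoidHomClass.isometry_of_norm _ fun x => by
    rw [CStarModule.norm_eq_sqrt_norm_inner_self (A := C(K, ℂ)) (x := S.ι k x), inner_ι,
      ← CStarModule.norm_eq_sqrt_norm_inner_self]

lemma ι_T (k : ℕ) (x : S.X k) : S.ι (k + 1) (S.T k x) = S.ι k x := by
  have hT : S.T k x = S.map k (k + 1) k.le_succ x := by rw [S.map_succ k k le_rfl, S.map_self]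
  rw [hT]
  exact congrArg S.preLim.toCompletion
    (DirectLimit.Module.of_f (f := S.map) (hij := k.le_succ) (x := x))

lemma denseRange_ι {ι : Type*} {F : ∀ k, ι → S.X k} (hF : ∀ k, DenseRange (F k)) :
    DenseRange fun p : ℕ × ι => S.ι p.1 (F p.1 p.2) := by
  refine fun x => S.preLim.denseRange_toCompletion.induction_on x isClosed_closure
    (DirectLimit.induction _ fun k x => ?_)
  exact (hF k).induction_on (p := fun x => S.ι k x ∈ closure _) x
    (isClosed_closure.preimage (S.isometry_ι k).continuous) fun i => subset_closure ⟨(k, i), rfl⟩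

end HilbSystem

namespace HilbMod

variable {X : HilbMod K}

lemma IsComplementedIn.mono {V W W' : Submodule C(K, ℂ) X.carrier} (h : X.IsComplementedIn V W)
    (hV : V ≤ W') (hW : W' ≤ W) : X.IsComplementedIn V W' := by
  refine ⟨hV, h.2.1, fun x hx => ?_⟩
  obtain ⟨m, hm, n, -, hn, rfl⟩ := h.2.2 x (hW hx)
  exact ⟨m, hm, n, (W'.add_mem_iff_right (hV hm)).1 hx, hn, rfl⟩

end HilbMod

namespace TransferOperator

/-- `D` is an invertible dilation of the Hilbert module `X`: it is `α`-semilinear and intertwines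
the inner products through `L`. -/
structure IsDilation (τ : TransferOperator K) {X : HilbMod K} (D : X.carrier ≃L[ℂ] X.carrier) :
    Prop where
  map_smul : ∀ (f : C(K, ℂ)) x, D (f • x) = τ.α f • D x
  L_inner : ∀ x y, τ.L (inner C(K, ℂ) (D x) (D y)) = inner C(K, ℂ) x y

/-- The unit vector `φ` satisfies the scaling equation `D φ = φ · m`. -/
structure IsScalingVector {X : HilbMod K} (D : X.carrier ≃L[ℂ] X.carrier) (m : C(K, ℂ)) (φ : X) :
    Prop where
  inner_self : inner C(K, ℂ) φ φ = 1
  map_eq : D φ = m • φ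

variable {τ : TransferOperator K} {X : HilbMod K} {D : X.carrier ≃L[ℂ] X.carrier} {m : C(K, ℂ)}
  {φ : X}

lemma IsScalingVector.isScalingFunction (hφ : IsScalingVector D m φ) {D' : X.Iso (X.tensor τ.exel)}
    (hD' : ∀ x, D'.toFun x = X.tmul τ.exel (D x) (τ.toExel 1)) :
    IsScalingFunction τ.exel (τ.toExel m) X D' φ :=
  ⟨hφ.inner_self, by rw [hD', hφ.map_eq, HilbMod.smul_tmul, left_toExel, mul_one]⟩

namespace IsDilation

lemma L_inner_symm (hD : τ.IsDilation D) (x y : X) :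
    inner C(K, ℂ) (D.symm x) (D.symm y) = τ.L (inner C(K, ℂ) x y) := by
  rw [← hD.L_inner, D.apply_symm_apply, D.apply_symm_apply]

lemma inner_iterate_symm (hD : τ.IsDilation D) (k : ℕ) (x y : X) :
    inner C(K, ℂ) (D.symm^[k] x) (D.symm^[k] y) = τ.L^[k] (inner C(K, ℂ) x y) := by
  induction k with
  | zero => rfl
  | succ k ih =>
    rw [Function.iterate_succ_apply', Function.iterate_succ_apply', Function.iterate_succ_apply',
      hD.L_inner_symm, ih]

lemma isFilter (hD : τ.IsDilation D) (hφ : IsScalingVector D m φ) :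
    τ.exel.IsFilter (τ.toExel m) := by
  rw [Corr.IsFilter, inner_toExel, ← hφ.inner_self, ← hD.L_inner, hφ.map_eq,
    CStarModule.inner_op_smul_left, CStarModule.inner_op_smul_right, hφ.inner_self, mul_one,
    mul_comm]

lemma symm_smul_scaling (hD : τ.IsDilation D) (hφ : IsScalingVector D m φ) (f : C(K, ℂ)) :
    D.symm ((m * τ.α f) • φ) = f • φ := by
  rw [D.symm_apply_eq, hD.map_smul, hφ.map_eq, smul_smul, mul_comm]

lemma exists_tensorIso (hD : τ.IsDilation D) :
    ∃ D' : X.Iso (X.tensor τ.exel), ∀ x, D'.toFun x = X.tmul τ.exel (D x) (τ.toExel 1) := by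
  have toExel_eq : ∀ x f, X.tmul τ.exel x (τ.toExel f) = X.tmul τ.exel (f • x) (τ.toExel 1) :=
    fun x f => by rw [HilbMod.smul_tmul, left_toExel, mul_one]
  let W : Submodule ℂ (X.tensor τ.exel).carrier :=
    LinearMap.range ((X.tmulL τ.exel).flip (τ.toExel 1)).toLinearMap
  have hW : DenseRange fun x => X.tmul τ.exel (D x) (τ.toExel 1) :=
    (HilbMod.dense_of_tmul_mem denseRange_id τ.denseRange_toExel W fun x f =>
      ⟨f • x, (toExel_eq x f).symm⟩).mono <| by
        rintro _ ⟨x, rfl⟩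
        exact ⟨D.symm x, congrArg (X.tmul τ.exel · _) (D.apply_symm_apply x)⟩
  refine HilbMod.exists_iso_of_inner_eq (S := fun x : X => x) denseRange_id hW fun x y => ?_
  rw [HilbMod.inner_tmul, left_toExel, inner_toExel, star_one, one_mul, mul_one, hD.L_inner]

lemma isComplementedIn_top (hD : τ.IsDilation D) {V W : Submodule C(K, ℂ) X.carrier}
    (hV : X.IsComplementedIn V ⊤) (hW : ∀ x, x ∈ W ↔ D x ∈ V) : X.IsComplementedIn W ⊤ := by
  refine ⟨le_top, ?_, fun x _ => ?_⟩
  · rw [show (W : Set X.carrier) = D ⁻¹' V from Set.ext hW]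
    exact hV.2.1.preimage D.continuous
  · obtain ⟨y, hy, n, -, hn, hx⟩ := hV.2.2 (D x) trivial
    refine ⟨D.symm y, (hW _).2 (by rwa [D.apply_symm_apply]), D.symm n, trivial, fun v hv => ?_, ?_⟩
    · rw [← hD.L_inner, D.apply_symm_apply, hn _ ((hW v).1 hv), map_zero]
    · rw [← map_add, ← hx, D.symm_apply_apply]

lemma isProjectiveMRA (hD : τ.IsDilation D) (hφ : IsScalingVector D m φ)
    {V : ℕ → Submodule C(K, ℂ) X.carrier}
    (hV : ∀ k x, x ∈ V k ↔ D^[k] x ∈ Submodule.span C(K, ℂ) {φ})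
    (hd : Dense (⋃ k, (V k : Set X.carrier))) : IsProjectiveMRA X D V := by
  have hcompl : ∀ k, X.IsComplementedIn (V k) ⊤ := fun k => by
    induction k with
    | zero =>
      rw [show V 0 = Submodule.span C(K, ℂ) {φ} from Submodule.ext (hV 0)]
      exact HilbMod.isComplementedIn_span_singleton hφ.inner_self
    | succ k ih => exact hD.isComplementedIn_top ih fun x => (hV (k + 1) x).trans (hV k _).symm
  have hmono : ∀ k, V k ≤ V (k + 1) := fun k x hx => by
    rw [hV, Submodule.mem_span_singleton] at hx ⊢
    obtain ⟨f, hf⟩ := hx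
    exact ⟨m * τ.α f, by
      rw [Function.iterate_succ_apply', ← hf, ← D.symm_apply_eq, hD.symm_smul_scaling hφ]⟩
  exact
    { complemented_zero := hcompl 0
      eq_preimage := fun k => Set.ext fun x => (hV k x).trans (hV 0 _).symm
      complemented_succ := fun k => (hcompl k).mono (hmono k) le_top
      dense := hd }

lemma exists_limIso (hD : τ.IsDilation D) (hφ : IsScalingVector D m φ)
    (hd : DenseRange fun p : ℕ × C(K, ℂ) => D.symm^[p.1] (p.2 • φ))
    (hm : τ.exel.IsFilter (τ.toExel m)) :
    ∃ Q : (τ.exel.filterSystem (τ.toExel m) hm).lim.Iso X, ∀ k f,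
      Q.toFun ((τ.exel.filterSystem (τ.toExel m) hm).ι k (τ.toPow k f)) =
        D.symm^[k] (f • φ) := by
  set S := τ.exel.filterSystem (τ.toExel m) hm
  let a (f : C(K, ℂ)) : C(K, ℂ) := m * τ.α f
  have hS : ∀ k f, S.ι (k + 1) (τ.toPow (k + 1) (a f)) = S.ι k (τ.toPow k f) := fun k f => by
    rw [← τ.tmul_toPow]
    exact S.ι_T k _
  have hT : ∀ k f, D.symm^[k + 1] (a f • φ) = D.symm^[k] (f • φ) := fun k f => by
    rw [Function.iterate_succ_apply, hD.symm_smul_scaling hφ]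
  have hlevel : ∀ k f g, inner C(K, ℂ) (S.ι k (τ.toPow k f)) (S.ι k (τ.toPow k g)) =
      inner C(K, ℂ) (D.symm^[k] (f • φ)) (D.symm^[k] (g • φ)) := fun k f g => by
    rw [hD.inner_iterate_symm, CStarModule.inner_op_smul_left, CStarModule.inner_op_smul_right,
      hφ.inner_self, mul_one, mul_comm]
    exact (S.inner_ι k _ _).trans (τ.inner_toPow k f g)
  obtain ⟨Q, hQ⟩ := HilbMod.exists_iso_of_inner_eq
    (S.denseRange_ι τ.denseRange_toPow) hd fun ⟨k, f⟩ ⟨l, g⟩ => by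
      have := hlevel (k + l) (a^[l] f) (a^[k] g)
      rw [apply_add_iterate (F := fun k f => S.ι k (τ.toPow k f)) hS,
        apply_add_iterate (F := fun k f => D.symm^[k] (f • φ)) hT, add_comm k l,
        apply_add_iterate (F := fun k f => S.ι k (τ.toPow k f)) hS,
        apply_add_iterate (F := fun k f => D.symm^[k] (f • φ)) hT] at this
      exact this
  exact ⟨Q, fun k f => hQ (k, f)⟩

lemma exists_projectiveMRA (hD : τ.IsDilation D) (hφ : IsScalingVector D m φ)
    (hd : DenseRange fun p : ℕ × C(K, ℂ) => D.symm^[p.1] (p.2 • φ)) (hτ : τ.IsBoundedBelow)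
    (hm : τ.exel.IsFilter (τ.toExel m)) :
    ∃ Q : (τ.exel.filterSystem (τ.toExel m) hm).lim.Iso X,
      IsProjectiveMRA X D fun k =>
        (LinearMap.range ((τ.exel.filterSystem (τ.toExel m) hm).ι k)).map
          Q.toLinearEquiv.toLinearMap := by
  obtain ⟨Q, hQ⟩ := hD.exists_limIso hφ hd hm
  set V : ℕ → Submodule C(K, ℂ) X.carrier := fun k =>
    (LinearMap.range ((τ.exel.filterSystem (τ.toExel m) hm).ι k)).map Q.toLinearEquiv.toLinearMap
  have mem_V : ∀ k x, x ∈ V k ↔ ∃ f : C(K, ℂ), D.symm^[k] (f • φ) = x := fun k x => by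
    constructor
    · rintro ⟨_, ⟨n, rfl⟩, rfl⟩
      obtain ⟨f, rfl⟩ := hτ.surjective_toPow k n
      exact ⟨f, (hQ k f).symm⟩
    · rintro ⟨f, rfl⟩
      exact ⟨_, ⟨τ.toPow k f, rfl⟩, hQ k f⟩
  refine ⟨Q, hD.isProjectiveMRA hφ (fun k x => ?_) (hd.mono ?_)⟩
  · rw [mem_V, Submodule.mem_span_singleton]
    exact exists_congr fun f =>
      ⟨fun h => h ▸ (Function.LeftInverse.iterate D.apply_symm_apply k _).symm,
        fun h => h ▸ Function.LeftInverse.iterate D.symm_apply_apply k x⟩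
  · rintro _ ⟨⟨k, f⟩, rfl⟩
    exact Set.mem_iUnion.2 ⟨k, (mem_V k _).2 ⟨f, rfl⟩⟩

end IsDilation

lemma IsBoundedBelow.exists_isDilation (hτ : τ.IsBoundedBelow)
    {P : PreHilbMod K} (S : P.carrier ≃ₗ[ℂ] P.carrier)
    (map_smul : ∀ (f : C(K, ℂ)) x, S (f • x) = τ.α f • S x)
    (L_form : ∀ x y, τ.L (P.form (S x) (S y)) = P.form x y) :
    ∃ D : P.completion.carrier ≃L[ℂ] P.completion.carrier,
      τ.IsDilation D ∧ ∀ x, D (P.toCompletion x) = P.toCompletion (S x) := by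
  obtain ⟨B, hB⟩ := hτ
  obtain ⟨C, hC⟩ := τ.exists_norm_L_le
  let e : P.carrier →ₗ[ℂ] P.completion.carrier := P.toCompletion.restrictScalars ℂ
  have hS : ∃ R : ℝ, ∀ x, ‖e (S x)‖ ≤ R * ‖e x‖ :=
    ⟨√B, fun x => PreHilbMod.norm_toCompletion_le <|
      (hB _ (P.form_self_nonneg (S x))).trans_eq (by rw [L_form])⟩
  have hS_symm : ∃ R : ℝ, ∀ x, ‖e (S.symm x)‖ ≤ R * ‖e x‖ :=
    ⟨√C, fun x => PreHilbMod.norm_toCompletion_le <| by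
      rw [← L_form, S.apply_symm_apply]
      exact hC (P.form x x)⟩
  let D := S.extend e e P.denseRange_toCompletion hS P.denseRange_toCompletion hS_symm
  have hD : ∀ x, D (P.toCompletion x) = P.toCompletion (S x) :=
    S.extend_eq e e P.denseRange_toCompletion hS P.denseRange_toCompletion hS_symm
  refine ⟨D, ⟨fun f x => ?_, fun x y => ?_⟩, hD⟩
  · refine P.denseRange_toCompletion.induction_on x (isClosed_eq
      (D.continuous.comp (continuous_const_smul f))
      ((continuous_const_smul (τ.α f)).comp D.continuous)) fun x => ?_
    rw [← LinearMap.map_smul, hD, hD, map_smul, LinearMap.map_smul]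
  · refine P.denseRange_toCompletion.induction_on₂ (isClosed_eq ?_ ?_) (fun x y => ?_) x y
    · exact τ.continuous_L.comp
        (CStarModule.continuous_inner.comp (D.continuous.prodMap D.continuous))
    · exact CStarModule.continuous_inner
    · rw [hD, hD]
      exact (congrArg τ.L (P.completion_inner_coe _ _)).trans
        ((L_form x y).trans (P.completion_inner_coe x y).symm)

end TransferOperator

end Dilations

/-! ### Shifts and projections of paths -/

open MeasureTheory

namespace FinDigraph

variable {G : FinDigraph.{u}} {w : G.E → ℂ}

instance : T2Space G.InfPath :=
  inferInstanceAs (T2Space {c : ℕ → G.E // ∀ i, G.s (c i) = G.r (c (i + 1))})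

lemma shift_cons (e : G.E) (c : G.InfPath) (h : G.s e = G.range c) :
    G.shift (G.cons e c h) = c :=
  rfl

lemma s_apply_zero (c : G.InfPath) : G.s (c.1 0) = G.range (G.shift c) := c.2 0

lemma cons_shift (c : G.InfPath) : G.cons (c.1 0) (G.shift c) (s_apply_zero c) = c :=
  Subtype.ext <| funext fun i => by cases i <;> rfl

lemma shift_eq_iff {d c : G.InfPath} :
    G.shift d = c ↔ ∃ e : G.Out (G.range c), d = G.cons e.1 c e.2 := by
  constructor
  · rintro rfl
    exact ⟨⟨d.1 0, s_apply_zero d⟩, (cons_shift d).symm⟩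
  · rintro ⟨e, rfl⟩
    exact shift_cons _ _ _

lemma iterate_shift_apply (k i : ℕ) (d : G.InfPath) : (G.shift^[k] d).1 i = d.1 (i + k) := by
  induction k generalizing d with
  | zero => rfl
  | succ k ih =>
    rw [Function.iterate_succ_apply, ih]
    exact congrArg d.1 (by ring)

lemma proj_apply (k i : ℕ) (d : G.BiPath) : (G.proj k d).1 i = d.1 (i - k) := rfl

lemma proj_succ_biShift (k : ℕ) (d : G.BiPath) : G.proj (k + 1) (G.biShift d) = G.proj k d :=
  Subtype.ext <| funext fun i =>
    congrArg d.1 (show (i : ℤ) - (k + 1 : ℕ) + 1 = i - k by push_cast; ring)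

lemma shift_proj_succ (k : ℕ) (d : G.BiPath) : G.shift (G.proj (k + 1) d) = G.proj k d :=
  Subtype.ext <| funext fun i =>
    congrArg d.1 (show ((i + 1 : ℕ) : ℤ) - (k + 1 : ℕ) = i - k by push_cast; ring)

lemma proj_zero_biShift (d : G.BiPath) : G.proj 0 (G.biShift d) = G.shift (G.proj 0 d) := by
  rw [← shift_proj_succ, proj_succ_biShift]

lemma cylinder_apply [DecidableEq G.E] (e : G.E) (c : G.InfPath) :
    G.cylinder e c = if c.1 0 = e then 1 else 0 := by
  change Set.indicator {e} (1 : G.E → ℂ) (c.1 0) = _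
  simp [Set.indicator_apply]

lemma filterFun_apply (w : G.E → ℂ) (c : G.InfPath) : G.filterFun w c = w (c.1 0) := by
  classical
  simp [filterFun, ContinuousMap.sum_apply, cylinder_apply]

lemma dilation_apply (x : C(G.BiPath, ℂ)) (d : G.BiPath) :
    G.dilation w x d = w (d.1 0) * x (G.biShift d) :=
  congrArg (· * x (G.biShift d)) (filterFun_apply w (G.proj 0 d))

/-! ### The law of the past -/

/-- The family of choices which uses `η` at time `0` and `ω` from time `1` on, for a pair
`q = (η, ω)`. -/
def consChoice (q : ((v : G.V) → G.Out v) × G.Choice) : G.Choice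
  | (0, v) => q.1 v
  | (n + 1, v) => q.2 (n, v)

lemma measurable_consChoice : Measurable (consChoice (G := G)) := by
  refine measurable_pi_lambda _ fun p => ?_
  match p with
  | (0, v) => exact (measurable_pi_apply v).comp measurable_fst
  | (n + 1, v) => exact (measurable_pi_apply ((n, v) : ℕ × G.V)).comp measurable_snd

lemma preimage_consChoice_pi (s : Set (ℕ × G.V)) (t : ∀ p : ℕ × G.V, Set (G.Out p.2)) :
    consChoice ⁻¹' (s.pi t) = ((Prod.mk 0 ⁻¹' s).pi fun v => t (0, v)) ×ˢ
      ((Prod.map Nat.succ id ⁻¹' s).pi fun p => t (p.1 + 1, p.2)) := by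
  ext q
  constructor
  · exact fun h => ⟨fun v hv => h (0, v) hv, fun p hp => h (p.1 + 1, p.2) hp⟩
  · rintro ⟨h0, h1⟩ ⟨_ | n, v⟩ hp
    exacts [h0 v hp, h1 (n, v) hp]

lemma past_consChoice (η : (v : G.V) → G.Out v) (ω : G.Choice) (c : G.InfPath) (n : ℕ) :
    G.past (consChoice (η, ω)) c (n + 1) =
      G.past ω (G.cons (η (G.range c)).1 c (η (G.range c)).2) n := by
  induction n with
  | zero => rfl
  | succ n ih => exact congrArg (fun e => (ω (n + 1, G.r e)).1) ih

lemma extend_consChoice (η : (v : G.V) → G.Out v) (ω : G.Choice) (c : G.InfPath) :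
    G.extend (consChoice (η, ω)) c =
      G.biShift (G.extend ω (G.cons (η (G.range c)).1 c (η (G.range c)).2)) := by
  refine Subtype.ext (funext fun i => ?_)
  match i with
  | Int.ofNat n => rfl
  | Int.negSucc 0 => rfl
  | Int.negSucc (n + 1) => exact past_consChoice η ω c n

lemma prod_preimage_zero_mul_prod_preimage_succ {V M : Type*} [CommMonoid M]
    (s : Finset (ℕ × V)) (a : ℕ × V → M) :
    (∏ v ∈ s.preimage (Prod.mk 0) (Prod.mk_right_injective 0).injOn, a (0, v)) *
      (∏ p ∈ s.preimage (Prod.map Nat.succ id)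
        (Nat.succ_injective.prodMap Function.injective_id).injOn, a (p.1 + 1, p.2)) =
      ∏ p ∈ s, a p := by
  classical
  have hrange : ∀ p : ℕ × V,
      p ∈ Set.range (Prod.map Nat.succ id) ↔ p ∉ Set.range (Prod.mk (β := V) 0) := by
    rintro ⟨_ | n, v⟩ <;> simp
  refine (congrArg₂ (· * ·)
    (Finset.prod_preimage' (Prod.mk 0) s (Prod.mk_right_injective 0).injOn a)
    (Finset.prod_preimage' (Prod.map Nat.succ id) s
      (Nat.succ_injective.prodMap Function.injective_id).injOn a)).trans ?_
  simp only [hrange]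
  exact Finset.prod_filter_mul_prod_filter_not _ _ _

lemma integral_edgeMeasure (v : G.V) (F : G.Out v → ℂ) :
    ∫ e, F e ∂G.edgeMeasure w v =
      ∑ e : G.Out v, ((‖w e.1‖ ^ 2 / Fintype.card (G.Out v) : ℝ) : ℂ) * F e := by
  rw [edgeMeasure, integral_finsetSum_measure fun e _ => Integrable.smul_measure
    (integrable_dirac (by simp)) ENNReal.ofReal_ne_top]
  refine Finset.sum_congr rfl fun e _ => ?_
  rw [integral_smul_measure, integral_dirac, ENNReal.toReal_ofReal (by positivity),
    Complex.real_smul]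

/-- The weights `|w(e)|² |s⁻¹(v)|⁻¹` of the edges `e` with source `v` form a probability vector, for
every vertex `v`. This includes the condition that every vertex emits an edge. -/
def IsNormalized (w : G.E → ℂ) : Prop :=
  ∀ v, ∑ e : G.Out v, ‖w e.1‖ ^ 2 / (Fintype.card (G.Out v) : ℝ) = 1

namespace IsNormalized

lemma isProbabilityMeasure_edgeMeasure (hw : IsNormalized w) (v : G.V) :
    IsProbabilityMeasure (G.edgeMeasure w v) := by
  refine ⟨?_⟩
  simp only [edgeMeasure, Measure.finsetSum_apply, Measure.smul_apply, measure_univ, smul_eq_mul,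
    mul_one]
  rw [← ENNReal.ofReal_sum_of_nonneg fun e _ => by positivity, hw v, ENNReal.ofReal_one]

lemma isProbabilityMeasure_choiceMeasure (hw : IsNormalized w) :
    IsProbabilityMeasure (G.choiceMeasure w) := by
  have := hw.isProbabilityMeasure_edgeMeasure
  exact inferInstanceAs (IsProbabilityMeasure (Measure.infinitePi _))

lemma isProbabilityMeasure_pathMeasure (hw : IsNormalized w) (c : G.InfPath) :
    IsProbabilityMeasure (G.pathMeasure w c) := by
  have := hw.isProbabilityMeasure_choiceMeasure
  exact Measure.isProbabilityMeasure_map (G.continuous_extend_left c).measurable.aemeasurable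

lemma map_consChoice (hw : IsNormalized w) :
    ((Measure.infinitePi fun v => G.edgeMeasure w v).prod (G.choiceMeasure w)).map consChoice =
      G.choiceMeasure w := by
  have := hw.isProbabilityMeasure_edgeMeasure
  refine Measure.eq_infinitePi (fun p : ℕ × G.V => G.edgeMeasure w p.2) fun s t ht => ?_
  have hzero := Measure.infinitePi_pi (fun v => G.edgeMeasure w v)
    (s := s.preimage (Prod.mk 0) (Prod.mk_right_injective 0).injOn)
    (t := fun v => t (0, v)) fun v _ => ht (0, v)
  have hsucc := Measure.infinitePi_pi (fun p : ℕ × G.V => G.edgeMeasure w p.2)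
    (s := s.preimage (Prod.map Nat.succ id)
      (Nat.succ_injective.prodMap Function.injective_id).injOn)
    (t := fun p => t (p.1 + 1, p.2)) fun p _ => ht (p.1 + 1, p.2)
  rw [Finset.coe_preimage] at hzero hsucc
  refine (Measure.map_apply measurable_consChoice
    (MeasurableSet.pi s.countable_toSet fun p _ => ht p)).trans ?_
  rw [preimage_consChoice_pi]
  refine (Measure.prod_prod _ _).trans ((congrArg₂ (· * ·) hzero hsucc).trans ?_)
  exact prod_preimage_zero_mul_prod_preimage_succ s fun p => G.edgeMeasure w p.2 (t p)

lemma integral_pathMeasure_eq_sum (hw : IsNormalized w) (F : C(G.BiPath, ℂ)) (c : G.InfPath) :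
    ∫ d, F d ∂G.pathMeasure w c = ∑ e : G.Out (G.range c),
      ((‖w e.1‖ ^ 2 / Fintype.card (G.Out (G.range c)) : ℝ) : ℂ) *
        ∫ d, F (G.biShift d) ∂G.pathMeasure w (G.cons e.1 c e.2) := by
  have := hw.isProbabilityMeasure_edgeMeasure
  have hF : StronglyMeasurable fun ω : G.Choice => F (G.extend ω c) :=
    (F.continuous.comp (G.continuous_extend_left c)).stronglyMeasurable
  have hint : Integrable (fun q => F (G.extend (consChoice q) c))
      ((Measure.infinitePi fun v => G.edgeMeasure w v).prod (G.choiceMeasure w)) :=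
    Integrable.of_bound (hF.comp_measurable measurable_consChoice).aestronglyMeasurable ‖F‖
      (Filter.Eventually.of_forall fun q => F.norm_coe_le_norm _)
  let H (e : G.Out (G.range c)) : ℂ :=
    ∫ ω, F (G.biShift (G.extend ω (G.cons e.1 c e.2))) ∂G.choiceMeasure w
  have heval := measurePreserving_eval_infinitePi (fun v => G.edgeMeasure w v) (G.range c)
  calc ∫ d, F d ∂G.pathMeasure w c
      = ∫ q, F (G.extend (consChoice q) c)
          ∂(Measure.infinitePi fun v => G.edgeMeasure w v).prod (G.choiceMeasure w) := by
        rw [G.integral_pathMeasure, ← integral_map measurable_consChoice.aemeasurable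
          hF.aestronglyMeasurable, hw.map_consChoice]
    _ = ∫ η, H (η (G.range c)) ∂Measure.infinitePi fun v => G.edgeMeasure w v := by
        simp only [integral_prod _ hint, extend_consChoice, H]
    _ = ∫ e, H e ∂G.edgeMeasure w (G.range c) := by
        rw [← heval.map_eq, integral_map heval.measurable.aemeasurable
          Measurable.of_discrete.aestronglyMeasurable]
    _ = _ := by
        rw [integral_edgeMeasure]
        refine Finset.sum_congr rfl fun e _ => congrArg _ ?_
        exact (G.integral_pathMeasure w _ (F.comp (G.biShift : C(G.BiPath, G.BiPath)))).symm

end IsNormalized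

/-! ### The measures `μ^c` -/

lemma setOf_iterate_shift_succ (k : ℕ) (c : G.InfPath) :
    {d : G.InfPath | G.shift^[k + 1] d = c} =
      ⋃ e : G.Out (G.range c), {d | G.shift^[k] d = G.cons e.1 c e.2} := by
  ext d
  rw [Set.mem_ofPred_eq, Function.iterate_succ_apply', shift_eq_iff, Set.mem_iUnion]
  rfl

lemma finite_iterate_shift (k : ℕ) (c : G.InfPath) :
    {d : G.InfPath | G.shift^[k] d = c}.Finite := by
  induction k generalizing c with
  | zero => exact Set.finite_singleton c
  | succ k ih =>
    rw [setOf_iterate_shift_succ]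
    exact Set.finite_iUnion fun e => ih _

lemma finsum_iterate_shift_succ (k : ℕ) (c : G.InfPath) (f : G.InfPath → ℂ) :
    ∑ᶠ (d : G.InfPath) (_ : G.shift^[k + 1] d = c), f d =
      ∑ e : G.Out (G.range c), ∑ᶠ (d : G.InfPath) (_ : G.shift^[k] d = G.cons e.1 c e.2), f d := by
  have hdisj : Pairwise (Function.onFun Disjoint fun e : G.Out (G.range c) =>
      {d : G.InfPath | G.shift^[k] d = G.cons e.1 c e.2}) := fun e e' hne =>
    Set.disjoint_left.2 fun d hd hd' => hne <| Subtype.ext <|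
      congrArg (fun c : G.InfPath => c.1 0) (hd.symm.trans hd')
  have hsum := finsum_mem_iUnion (f := f) hdisj fun e => finite_iterate_shift k _
  rw [← setOf_iterate_shift_succ] at hsum
  exact hsum.trans (finsum_eq_sum_of_fintype _)

lemma IsNormalized.integral_proj (hw : IsNormalized w) (c : G.InfPath) (k : ℕ)
    (x : C(G.InfPath, ℂ)) :
    ∫ d, x (G.proj k d) ∂G.pathMeasure w c = ∑ᶠ (d : G.InfPath) (_ : G.shift^[k] d = c),
      x d * ((∏ j ∈ Finset.range k,
        ‖w (d.1 j)‖ ^ 2 / Fintype.card (G.Out (G.s (d.1 j))) : ℝ) : ℂ) := by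
  induction k generalizing c with
  | zero =>
    have := hw.isProbabilityMeasure_choiceMeasure
    refine (G.integral_pathMeasure w c (x.comp (G.proj 0))).trans ?_
    simp [G.proj_extend]
  | succ k ih =>
    rw [finsum_iterate_shift_succ]
    refine (hw.integral_pathMeasure_eq_sum (x.comp (G.proj (k + 1))) c).trans
      (Finset.sum_congr rfl fun e _ => ?_)
    simp only [ContinuousMap.comp_apply, proj_succ_biShift]
    rw [ih, ← smul_eq_mul, smul_finsum]
    refine finsum_congr fun d => ?_
    rw [smul_finsum]
    refine finsum_congr fun hd => ?_
    have hedge : d.1 k = e.1 := by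
      have := iterate_shift_apply k 0 d
      rw [hd, zero_add] at this
      exact this.symm
    rw [Finset.prod_range_succ, hedge, e.2, smul_eq_mul]
    push_cast
    ring

lemma IsNormalized.isFibreMeasure (hw : IsNormalized w) (c : G.InfPath) :
    G.IsFibreMeasure w c (G.pathMeasure w c) where
  isProbabilityMeasure := hw.isProbabilityMeasure_pathMeasure c
  ae_fibre := by
    have hm : MeasurableSet {d : G.BiPath | G.proj 0 d = c} :=
      (isClosed_singleton.preimage (G.proj 0).continuous).measurableSet
    exact (ae_map_iff (G.continuous_extend_left c).measurable.aemeasurable hm).2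
      (Filter.Eventually.of_forall fun ω => G.proj_extend ω c)
  integral_proj := hw.integral_proj c

/-! ### The dilation of `X_∞(E)` -/

lemma transfer_L_apply (f : C(G.InfPath, ℂ)) (c : G.InfPath) :
    G.transfer.L f c = (Fintype.card (G.Out (G.range c)) : ℂ)⁻¹ *
      ∑ e : G.Out (G.range c), f (G.cons e.1 c e.2) := rfl

lemma isBoundedBelow_transfer : G.transfer.IsBoundedBelow := by
  refine ⟨Fintype.card G.E, fun f hf => (ContinuousMap.norm_le _ (by positivity)).2 fun d => ?_⟩
  let c := G.shift d
  let e₀ : G.Out (G.range c) := ⟨d.1 0, s_apply_zero d⟩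
  have : Nonempty (G.Out (G.range c)) := ⟨e₀⟩
  have hcard : Fintype.card (G.Out (G.range c)) ≤ Fintype.card G.E :=
    Fintype.card_le_of_injective (fun e => e.1) Subtype.val_injective
  have hle : f d ≤ Fintype.card (G.Out (G.range c)) * G.transfer.L f c :=
    calc f d = f (G.cons e₀.1 c e₀.2) := by rw [cons_shift]
      _ ≤ ∑ e : G.Out (G.range c), f (G.cons e.1 c e.2) :=
        Finset.single_le_sum (f := fun e : G.Out (G.range c) => f (G.cons e.1 c e.2))
          (fun e _ => hf _) (Finset.mem_univ e₀)
      _ = Fintype.card (G.Out (G.range c)) * G.transfer.L f c := by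
        rw [transfer_L_apply, mul_inv_cancel_left₀ (Nat.cast_ne_zero.2 Fintype.card_ne_zero)]
  calc ‖f d‖ ≤ ‖(Fintype.card (G.Out (G.range c)) : ℂ) * G.transfer.L f c‖ :=
        CStarAlgebra.norm_le_norm_of_nonneg_of_le (hf d) hle
    _ = Fintype.card (G.Out (G.range c)) * ‖G.transfer.L f c‖ := by
        rw [norm_mul, Complex.norm_natCast]
    _ ≤ Fintype.card G.E * ‖G.transfer.L f‖ := by
        gcongr
        exact (G.transfer.L f).norm_coe_le_norm c

lemma form_apply (x y : C(G.BiPath, ℂ)) (c : G.InfPath) :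
    (G.preBilateral w).form x y c = ∫ d, star (x d) * y d ∂G.pathMeasure w c := rfl

lemma IsNormalized.form_dilation_cons (hw : IsNormalized w) (x y : C(G.BiPath, ℂ)) (e : G.E)
    (c : G.InfPath) (h : G.s e = G.range c) :
    (G.preBilateral w).form (G.dilation w x) (G.dilation w y) (G.cons e c h) =
      ((‖w e‖ ^ 2 : ℝ) : ℂ) *
        ∫ d, (star x * y) (G.biShift d) ∂G.pathMeasure w (G.cons e c h) := by
  rw [form_apply, ← integral_const_mul]
  refine integral_congr_ae ?_
  filter_upwards [(hw.isFibreMeasure (G.cons e c h)).ae_fibre] with d hd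
  have hd₀ : d.1 0 = e := congrArg (fun c : G.InfPath => c.1 0) hd
  simp only [dilation_apply, hd₀, star_mul', RCLike.star_def, ContinuousMap.mul_apply,
    ContinuousMap.star_apply]
  push_cast
  rw [← Complex.conj_mul']
  ring

lemma IsNormalized.L_form_dilation (hw : IsNormalized w) (x y : C(G.BiPath, ℂ)) :
    G.transfer.L ((G.preBilateral w).form (G.dilation w x) (G.dilation w y)) =
      (G.preBilateral w).form x y := by
  ext c
  rw [transfer_L_apply, Finset.mul_sum]
  refine Eq.trans ?_ (hw.integral_pathMeasure_eq_sum (star x * y) c).symm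
  refine Finset.sum_congr rfl fun e _ => ?_
  rw [hw.form_dilation_cons]
  push_cast
  ring

/-- The dilation as a linear automorphism of `C(E^(-∞,∞))`. -/
def dilationEquiv (hw0 : ∀ e, w e ≠ 0) : C(G.BiPath, ℂ) ≃ₗ[ℂ] C(G.BiPath, ℂ) where
  toFun := G.dilation w
  map_add' x y := by ext d; simp [dilation_apply, mul_add]
  map_smul' z x := by ext d; simp [dilation_apply, mul_left_comm]
  invFun x :=
    { toFun d := (w (d.1 (-1)))⁻¹ * x (G.biShift.symm d)
      continuous_toFun := ((continuous_of_discreteTopology (f := fun e => (w e)⁻¹)).comp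
        (G.continuous_biEdge (-1))).mul (x.continuous.comp G.biShift.symm.continuous) }
  left_inv x := by
    ext d
    change (w (d.1 (-1)))⁻¹ * G.dilation w x (G.biShift.symm d) = x d
    rw [dilation_apply, G.biShift.apply_symm_apply]
    exact inv_mul_cancel_left₀ (hw0 _) _
  right_inv x := by
    ext d
    rw [dilation_apply]
    change w (d.1 0) * ((w (d.1 0))⁻¹ * x (G.biShift.symm (G.biShift d))) = x d
    rw [G.biShift.symm_apply_apply, mul_inv_cancel_left₀ (hw0 _)]

lemma dilation_comp_proj_zero_mul (f : C(G.InfPath, ℂ)) (x : C(G.BiPath, ℂ)) :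
    G.dilation w (f.comp (G.proj 0) * x) =
      (G.transfer.α f).comp (G.proj 0) * G.dilation w x := by
  ext d
  change _ * (f (G.proj 0 (G.biShift d)) * _) = f (G.shift (G.proj 0 d)) * (_ * _)
  rw [proj_zero_biShift, mul_left_comm]
  rfl

lemma IsNormalized.exists_isDilation (hw : IsNormalized w) (hw0 : ∀ e, w e ≠ 0) :
    ∃ D : (G.bilateral w).carrier ≃L[ℂ] (G.bilateral w).carrier, G.transfer.IsDilation D ∧
      ∀ x, D (G.toBilateral w x) = G.toBilateral w (G.dilation w x) :=
  TransferOperator.IsBoundedBelow.exists_isDilation isBoundedBelow_transfer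
    (P := G.preBilateral w) (dilationEquiv hw0) dilation_comp_proj_zero_mul hw.L_form_dilation

lemma smul_toBilateral (f : C(G.InfPath, ℂ)) (x : C(G.BiPath, ℂ)) :
    f • G.toBilateral w x = G.toBilateral w (f.comp (G.proj 0) * x) :=
  (map_smul (G.preBilateral w).toCompletion f (show (G.preBilateral w).carrier from x)).symm

lemma denseRange_toBilateral : DenseRange (G.toBilateral w) :=
  (G.preBilateral w).denseRange_toCompletion

lemma inner_toBilateral (x y : C(G.BiPath, ℂ)) :
    inner C(G.InfPath, ℂ) (G.toBilateral w x) (G.toBilateral w y) =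
      (G.preBilateral w).form x y :=
  PreHilbMod.completion_inner_coe _ _ _

lemma IsNormalized.norm_toBilateral_le (hw : IsNormalized w) (x : C(G.BiPath, ℂ)) :
    ‖G.toBilateral w x‖ ≤ ‖x‖ := by
  refine le_of_sq_le_sq ?_ (norm_nonneg x)
  rw [CStarModule.norm_sq_eq C(G.InfPath, ℂ), inner_toBilateral]
  refine (ContinuousMap.norm_le _ (by positivity)).2 fun c => ?_
  have := hw.isProbabilityMeasure_pathMeasure c
  refine (norm_integral_le_of_norm_le_const (C := ‖x‖ ^ 2)
    (Filter.Eventually.of_forall fun d => ?_)).trans_eq (by simp)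
  have := x.norm_coe_le_norm d
  simp only [ContinuousMap.mul_apply, ContinuousMap.star_apply, norm_mul, norm_star, ← sq]
  gcongr

lemma IsNormalized.continuous_toBilateral (hw : IsNormalized w) : Continuous (G.toBilateral w) :=
  AddMonoidHomClass.continuous_of_bound
    (AddMonoidHom.mk' (G.toBilateral w) (map_add (G.preBilateral w).toCompletion)) 1
    fun x => (hw.norm_toBilateral_le x).trans_eq (one_mul _).symm

lemma IsNormalized.isScalingVector (hw : IsNormalized w)
    {D : (G.bilateral w).carrier ≃L[ℂ] (G.bilateral w).carrier}
    (hD : ∀ x, D (G.toBilateral w x) = G.toBilateral w (G.dilation w x)) :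
    TransferOperator.IsScalingVector D (G.filterFun w) (G.toBilateral w 1) where
  inner_self := by
    rw [inner_toBilateral]
    ext c
    have := hw.isProbabilityMeasure_pathMeasure c
    simp [form_apply]
  map_eq := by
    rw [hD, smul_toBilateral]
    rfl

/-! ### Functions of finitely many past edges -/

lemma exists_comp_proj_of_le (g : C(G.InfPath, ℂ)) {k l : ℕ} (h : k ≤ l) :
    ∃ f : C(G.InfPath, ℂ), g.comp (G.proj k) = f.comp (G.proj l) := by
  induction l, h using Nat.le_induction with
  | base => exact ⟨g, rfl⟩
  | succ n _ ih =>
    obtain ⟨f, hf⟩ := ih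
    refine ⟨f.comp G.shift, hf.trans ?_⟩
    ext d
    exact congrArg f (shift_proj_succ n d).symm

lemma exists_comp_proj_eq_and_eq (f g : C(G.InfPath, ℂ)) (k l : ℕ) :
    ∃ (n : ℕ) (f' g' : C(G.InfPath, ℂ)),
      f.comp (G.proj k) = f'.comp (G.proj n) ∧ g.comp (G.proj l) = g'.comp (G.proj n) := by
  obtain ⟨f', hf⟩ := exists_comp_proj_of_le f (le_max_left k l)
  obtain ⟨g', hg⟩ := exists_comp_proj_of_le g (le_max_right k l)
  exact ⟨_, f', g', hf, hg⟩

variable (G) in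
/-- The functions on `E^(-∞,∞)` which depend on only finitely many of the past edges. -/
def cylinderAlgebra : StarSubalgebra ℂ C(G.BiPath, ℂ) where
  carrier := {F | ∃ (k : ℕ) (g : C(G.InfPath, ℂ)), F = g.comp (G.proj k)}
  mul_mem' := by
    rintro _ _ ⟨k, f, rfl⟩ ⟨l, g, rfl⟩
    obtain ⟨n, f', g', hf, hg⟩ := exists_comp_proj_eq_and_eq f g k l
    exact ⟨n, f' * g', by rw [hf, hg]; rfl⟩
  add_mem' := by
    rintro _ _ ⟨k, f, rfl⟩ ⟨l, g, rfl⟩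
    obtain ⟨n, f', g', hf, hg⟩ := exists_comp_proj_eq_and_eq f g k l
    exact ⟨n, f' + g', by rw [hf, hg]; rfl⟩
  algebraMap_mem' z := ⟨0, algebraMap ℂ _ z, rfl⟩
  star_mem' := by
    rintro _ ⟨k, f, rfl⟩
    exact ⟨k, star f, rfl⟩

lemma separatesPoints_cylinderAlgebra : (cylinderAlgebra G).toSubalgebra.SeparatesPoints := by
  classical
  intro d d' hne
  obtain ⟨i, hi⟩ : ∃ i, d.1 i ≠ d'.1 i := Function.ne_iff.1 (Subtype.coe_ne_coe.2 hne)
  let F : C(G.InfPath, ℂ) :=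
    (G.cylinder (d.1 i)).comp ⟨G.shift^[i.toNat], G.shift.continuous.iterate _⟩
  refine ⟨_, ⟨F.comp (G.proj (-i).toNat), ⟨(-i).toNat, F, rfl⟩, rfl⟩, ?_⟩
  have hF : ∀ b : G.BiPath, F (G.proj (-i).toNat b) = if b.1 i = d.1 i then 1 else 0 := fun b => by
    have hb : (G.shift^[i.toNat] (G.proj (-i).toNat b)).1 0 = b.1 i := by
      rw [iterate_shift_apply, proj_apply]
      exact congrArg b.1 (by lia)
    rw [← hb]
    exact cylinder_apply _ _
  simp [hF, hi.symm]

lemma dense_cylinderAlgebra : Dense (cylinderAlgebra G : Set C(G.BiPath, ℂ)) := by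
  rw [dense_iff_closure_eq, ← StarSubalgebra.topologicalClosure_coe,
    ContinuousMap.starSubalgebra_topologicalClosure_eq_top_of_separatesPoints
      (cylinderAlgebra G) separatesPoints_cylinderAlgebra, StarSubalgebra.coe_top]

lemma exists_dilation_comp_proj_succ (w : G.E → ℂ) (k : ℕ) (g : C(G.InfPath, ℂ)) :
    ∃ f : C(G.InfPath, ℂ), G.dilation w (g.comp (G.proj (k + 1))) = f.comp (G.proj k) := by
  obtain ⟨m, hm⟩ := exists_comp_proj_of_le (G.filterFun w) k.zero_le
  refine ⟨m * g, ?_⟩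
  rw [dilation, hm]
  ext d
  exact congrArg (fun c => m (G.proj k d) * g c) (proj_succ_biShift k d)

lemma exists_iterate_comp_proj {D : (G.bilateral w).carrier → (G.bilateral w).carrier}
    (hD : ∀ x, D (G.toBilateral w x) = G.toBilateral w (G.dilation w x)) (k : ℕ)
    (g : C(G.InfPath, ℂ)) :
    ∃ f : C(G.InfPath, ℂ), D^[k] (G.toBilateral w (g.comp (G.proj k))) = f • G.toBilateral w 1 := by
  induction k generalizing g with
  | zero => exact ⟨g, by rw [smul_toBilateral, mul_one]; rfl⟩
  | succ k ih =>
    obtain ⟨f, hf⟩ := exists_dilation_comp_proj_succ w k g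
    rw [Function.iterate_succ_apply, hD, hf]
    exact ih f

lemma IsNormalized.denseRange_iterate_symm (hw : IsNormalized w)
    {D : (G.bilateral w).carrier ≃L[ℂ] (G.bilateral w).carrier}
    (hD : ∀ x, D (G.toBilateral w x) = G.toBilateral w (G.dilation w x)) :
    DenseRange fun p : ℕ × C(G.InfPath, ℂ) => D.symm^[p.1] (p.2 • G.toBilateral w 1) := by
  refine (denseRange_toBilateral.dense_image hw.continuous_toBilateral
    dense_cylinderAlgebra).mono ?_
  rintro _ ⟨_, ⟨k, g, rfl⟩, rfl⟩
  obtain ⟨f, hf⟩ := exists_iterate_comp_proj hD k g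
  exact ⟨(k, f), (congrArg D.symm^[k] hf).symm.trans
    (Function.LeftInverse.iterate D.symm_apply_apply k _)⟩

end FinDigraph

end

theorem mainTheorem10_general (G : FinDigraph.{u}) (hsnk : G.NoSinks)
    (w : G.E → ℂ) (hw0 : ∀ e, w e ≠ 0)
    (hw : ∀ v, ∑ e : G.Out v, ‖w e.1‖ ^ 2 = Fintype.card (G.Out v)) :
    (∀ c, G.IsFibreMeasure w c (G.pathMeasure w c)) ∧
    ∃ hm : G.transfer.exel.IsFilter (G.transfer.toExel (G.filterFun w)),
    ∃ D : G.bilateral w ≃L[ℂ] G.bilateral w,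
      (∀ x, D (G.toBilateral w x) = G.toBilateral w (G.dilation w x)) ∧
      (∃ D' : (G.bilateral w).Iso ((G.bilateral w).tensor G.transfer.exel),
        (∀ x, D'.toFun x = (G.bilateral w).tmul G.transfer.exel (D x) (G.transfer.toExel 1)) ∧
        IsScalingFunction G.transfer.exel (G.transfer.toExel (G.filterFun w)) (G.bilateral w) D'
          (G.toBilateral w 1)) ∧
      ∃ Q : (G.transfer.exel.filterSystem (G.transfer.toExel (G.filterFun w)) hm).lim.Iso
          (G.bilateral w),
        IsProjectiveMRA (G.bilateral w) D fun k =>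
          (LinearMap.range ((G.transfer.exel.filterSystem
            (G.transfer.toExel (G.filterFun w)) hm).ι k)).map Q.toLinearEquiv.toLinearMap := by
  have hn : FinDigraph.IsNormalized w := fun v => by
    have : Nonempty (G.Out v) := let ⟨e, he⟩ := hsnk v; ⟨⟨e, he⟩⟩
    rw [← Finset.sum_div, hw, div_self (Nat.cast_ne_zero.2 Fintype.card_ne_zero)]
  obtain ⟨D, isDilation, hD⟩ := hn.exists_isDilation hw0
  have hφ := hn.isScalingVector hD
  obtain ⟨D', hD'⟩ := isDilation.exists_tensorIso
  exact ⟨hn.isFibreMeasure, isDilation.isFilter hφ, D, hD,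
    ⟨D', hD', hφ.isScalingFunction hD'⟩,
    isDilation.exists_projectiveMRA hφ (hn.denseRange_iterate_symm hD)
      FinDigraph.isBoundedBelow_transfer _⟩

theorem mainTheorem10 (G : FinDigraph.{u}) (hsrc : G.NoSources) (hsnk : G.NoSinks)
    (w : G.E → ℂ) (hw0 : ∀ e, w e ≠ 0)
    (hw : ∀ v, ∑ e : G.Out v, ‖w e.1‖ ^ 2 = Fintype.card (G.Out v)) :
    (∀ c, G.IsFibreMeasure w c (G.pathMeasure w c)) ∧
    ∃ hm : G.transfer.exel.IsFilter (G.transfer.toExel (G.filterFun w)),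
    ∃ D : G.bilateral w ≃L[ℂ] G.bilateral w,
      (∀ x, D (G.toBilateral w x) = G.toBilateral w (G.dilation w x)) ∧
      (∃ D' : (G.bilateral w).Iso ((G.bilateral w).tensor G.transfer.exel),
        (∀ x, D'.toFun x = (G.bilateral w).tmul G.transfer.exel (D x) (G.transfer.toExel 1)) ∧
        IsScalingFunction G.transfer.exel (G.transfer.toExel (G.filterFun w)) (G.bilateral w) D'
          (G.toBilateral w 1)) ∧
      ∃ Q : (G.transfer.exel.filterSystem (G.transfer.toExel (G.filterFun w)) hm).lim.Iso
          (G.bilateral w),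
        IsProjectiveMRA (G.bilateral w) D fun k =>
          (LinearMap.range ((G.transfer.exel.filterSystem
            (G.transfer.toExel (G.filterFun w)) hm).ι k)).map Q.toLinearEquiv.toLinearMap :=
  mainTheorem10_general G hsnk w hw0 hw
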